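/- Let $S^1$ be the unit circle. A *lamination* $\Lambda$ is a closed set of unordered pairs of distinct points of $S^1$ (*leaves*), no two of which are linked; it is drawn in the unit disk by chords. A *gap* is the closure of a connected component of the open disk minus the chords of $\Lambda$. $\Lambda$ is *dense* if the endpoints of its leaves are dense in $S^1$, *very full* if each gap is a finite-sided ideal polygon, and *loose* if any two distinct leaves sharing an endpoint are edges of the same gap. For $f\in \mathrm{Homeo}^+(S^1)$, a fixed point $p$ is *attracting* (respectively *repelling*) if $p$ lies in the interior of a compact arc $I\subset S^1$ that contains no other fixed point of $f$ and satisfies $f(I)\subsetneq I$ (respectively $f(I)\supsetneq I$). $f$ is *hyperbolic* if it has exactly two fixed points, one attracting and one repelling. $f$ is *pseudo-Anosov-like* (p-A-like) if it is not hyperbolic and some power $f^n$, $n\ge 1$, has a finite, positive, even number of fixed points, alternating around $S^1$ between attracting and repelling. A subgroup $G\le \mathrm{Homeo}^+(S^1)$ is *pseudo-fibered* if it is finitely generated, discrete (in the topology of uniform convergence), admits a dense $G$-invariant lamination, admits two very full, loose, $G$-invariant laminations whose sets of endpoints are disjoint, and each nontrivial element of $G$ has at most countably many fixed points. It is *mixed*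 if moreover it contains at least one hyperbolic and at least one p-A-like element, and *tame* if for all hyperbolic $g,h\in G$ the product $gh$ is hyperbolic or the identity. **Lemma.** Let $G$ be a tame mixed pseudo-fibered group. The set $H$ consisting of the hyperbolic elements of $G$ and the identity is a normal subgroup of $G$. For every p-A-like element $\phi\in G$, conjugation $h\mapsto \phi h\phi^{-1}$ induces a nontrivial element of $\mathrm{Out}(H)=\mathrm{Aut}(H)/\mathrm{Inn}(H)$, and this outer automorphism has no periodic nontrivial conjugacy class: if $C\neq\{1\}$ is a conjugacy class of $H$ and $n\ge 1$, then $\phi^n C\phi^{-n}\neq C$. -/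

import Mathlib

namespace CircleLam

/-! ### Cyclic order and orientation-preserving homeomorphisms of the circle -/

/-- `a, b, c` are pairwise distinct points of the unit circle that are met in this order when
the circle is run through counterclockwise: the triangle `a b c` has positive signed area. -/
def Ccw (a b c : Circle) : Prop :=
  0 < ((starRingEnd ℂ) ((b : ℂ) - (a : ℂ)) * ((c : ℂ) - (a : ℂ))).im

/-- The closed arc from `u` counterclockwise to `v` (used only for `u ≠ v`). -/
def closedArc (u v : Circle) : Set Circle := {x | x = u ∨ x = v ∨ Ccw u x v}

/-- The group of orientation-preserving homeomorphisms of the circle. -/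
def HomeoPlus : Subgroup (Circle ≃ₜ Circle) where
  carrier := {f | ∀ a b c, Ccw (f a) (f b) (f c) ↔ Ccw a b c}
  mul_mem' := by
    intro f g hf hg a b c
    exact (hf (g a) (g b) (g c)).trans (hg a b c)
  one_mem' := fun _ _ _ => Iff.rfl
  inv_mem' := by
    intro f hf a b c
    have h := hf (f⁻¹ a) (f⁻¹ b) (f⁻¹ c)
    have e : ∀ x, f (f⁻¹ x) = x := fun x => f.apply_symm_apply x
    rw [e, e, e] at h
    exact h.symm

/-! ### Dynamics of a single homeomorphism -/

/-- The set of fixed points. -/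
def Fix (f : Circle ≃ₜ Circle) : Set Circle := {x | f x = x}

/-- `p` is a fixed point in the interior of a compact arc `I` that contains no other fixed point
and is mapped by `f` properly into itself. -/
def IsAttracting (f : Circle ≃ₜ Circle) (p : Circle) : Prop :=
  f p = p ∧ ∃ u v : Circle, Ccw u p v ∧ (∀ x ∈ closedArc u v, f x = x → x = p) ∧
    f '' closedArc u v ⊂ closedArc u v

/-- `p` is a fixed point in the interior of a compact arc `J` that contains no other fixed point
and is mapped by `f` onto a strictly larger set. -/
def IsRepelling (f : Circle ≃ₜ Circle) (p : Circle) : Prop :=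
  f p = p ∧ ∃ u v : Circle, Ccw u p v ∧ (∀ x ∈ closedArc u v, f x = x → x = p) ∧
    closedArc u v ⊂ f '' closedArc u v

/-- Exactly two fixed points, one attracting and one repelling. -/
def IsHyperbolic (f : Circle ≃ₜ Circle) : Prop :=
  ∃ a r : Circle, a ≠ r ∧ Fix f = {a, r} ∧ IsAttracting f a ∧ IsRepelling f r

/-- `f` has a positive, even, finite number of fixed points, and of any two distinct fixed points
`p`, `q` that are consecutive on the circle one is attracting and the other is repelling. -/
def HasAlternatingFixedPoints (f : Circle ≃ₜ Circle) : Prop :=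
  (Fix f).Finite ∧ 0 < (Fix f).ncard ∧ Even (Fix f).ncard ∧
    ∀ p ∈ Fix f, ∀ q ∈ Fix f, p ≠ q → (∀ x ∈ Fix f, ¬ Ccw p x q) →
      (IsAttracting f p ∧ IsRepelling f q) ∨ (IsRepelling f p ∧ IsAttracting f q)

/-- Pseudo-Anosov-like homeomorphisms. -/
def IsPALike (f : Circle ≃ₜ Circle) : Prop :=
  ¬ IsHyperbolic f ∧ ∃ n : ℕ, 0 < n ∧ HasAlternatingFixedPoints (f ^ n)

/-! ### Laminations -/

/-- `c` and `d` lie in the two different components of the circle minus `{a, b}`. -/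
def Linked (a b c d : Circle) : Prop :=
  (Ccw a c b ∧ Ccw b d a) ∨ (Ccw a d b ∧ Ccw b c a)

/-- A lamination of the circle: a closed set of unordered pairs of distinct points that are
pairwise unlinked. It is given by its (symmetric) preimage in the space of ordered pairs of
distinct points. -/
structure Lamination where
  leaves : Set {q : Circle × Circle // q.1 ≠ q.2}
  symm : ∀ q, q ∈ leaves → (⟨q.1.swap, q.2.symm⟩ : {q : Circle × Circle // q.1 ≠ q.2}) ∈ leaves
  closed : IsClosed leaves
  unlinked : ∀ q ∈ leaves, ∀ r ∈ leaves, ¬ Linked q.1.1 q.1.2 r.1.1 r.1.2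

namespace Lamination

/-- `a` and `b` are distinct and `{a, b}` is a leaf. -/
def IsLeaf (L : Lamination) (a b : Circle) : Prop := ∃ h : a ≠ b, ⟨(a, b), h⟩ ∈ L.leaves

/-- The set of endpoints of leaves. -/
def endpoints (L : Lamination) : Set Circle := {a | ∃ b, L.IsLeaf a b}

/-- The straight chord of the unit disk with endpoints `a` and `b`. -/
def chord (a b : Circle) : Set ℂ := segment ℝ (a : ℂ) (b : ℂ)

/-- The union of the chords spanned by the leaves. -/
def chords (L : Lamination) : Set ℂ := {z | ∃ a b, L.IsLeaf a b ∧ z ∈ chord a b}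

/-- The part of the open unit disk that is not covered by leaves. -/
def complement (L : Lamination) : Set ℂ := Metric.ball (0 : ℂ) 1 \ L.chords

/-- A gap: the closure of a connected component of the disk minus the lamination. -/
def IsGap (L : Lamination) (P : Set ℂ) : Prop :=
  ∃ z ∈ L.complement, P = closure (connectedComponentIn L.complement z)

/-- The leaf `{a, b}` is an edge (boundary leaf) of the gap `P`. -/
def IsEdge (L : Lamination) (a b : Circle) (P : Set ℂ) : Prop :=
  L.IsGap P ∧ L.IsLeaf a b ∧ chord a b ⊆ frontier P

/-- The endpoints of leaves are dense in the circle. -/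
def IsDense (L : Lamination) : Prop := Dense L.endpoints

/-- Every gap is a finite-sided ideal polygon. -/
def IsVeryFull (L : Lamination) : Prop :=
  ∀ P, L.IsGap P → ∃ F : Finset Circle, 3 ≤ F.card ∧
    P = convexHull ℝ ((fun a : Circle => (a : ℂ)) '' (F : Set Circle))

/-- Two different leaves that share an endpoint are edges of the same gap. -/
def IsLoose (L : Lamination) : Prop :=
  ∀ p x y : Circle, L.IsLeaf p x → L.IsLeaf p y → x ≠ y →
    ∃ P, L.IsEdge p x P ∧ L.IsEdge p y P

/-- The lamination is preserved set-wise by every element of `G`. -/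
def IsInvariant (L : Lamination) (G : Subgroup (Circle ≃ₜ Circle)) : Prop :=
  ∀ g ∈ G, ∀ a b : Circle, L.IsLeaf (g a) (g b) ↔ L.IsLeaf a b

end Lamination

/-! ### Classes of groups of circle homeomorphisms -/

/-- `G` is a discrete set of continuous self-maps of the circle, in the compact-open topology
(the topology of uniform convergence). -/
def IsDiscreteGroup (G : Subgroup (Circle ≃ₜ Circle)) : Prop :=
  IsDiscrete ((fun g : Circle ≃ₜ Circle => (⟨g, g.continuous⟩ : C(Circle, Circle))) ''
    (G : Set (Circle ≃ₜ Circle)))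

/-- Discrete groups of orientation-preserving homeomorphisms that admit a dense invariant
lamination. -/
def IsLaminar (G : Subgroup (Circle ≃ₜ Circle)) : Prop :=
  G ≤ HomeoPlus ∧ IsDiscreteGroup G ∧ ∃ L : Lamination, L.IsDense ∧ L.IsInvariant G

/-- Pseudo-fibered groups. -/
def IsPseudoFibered (G : Subgroup (Circle ≃ₜ Circle)) : Prop :=
  G.FG ∧ IsLaminar G ∧
    (∃ L₁ L₂ : Lamination,
      L₁.IsVeryFull ∧ L₁.IsLoose ∧ L₁.IsInvariant G ∧
      L₂.IsVeryFull ∧ L₂.IsLoose ∧ L₂.IsInvariant G ∧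
      Disjoint L₁.endpoints L₂.endpoints) ∧
    ∀ g ∈ G, g ≠ 1 → (Fix g).Countable

/-- Mixed pseudo-fibered groups: some element is hyperbolic, and some element is
pseudo-Anosov-like. -/
def IsMixed (G : Subgroup (Circle ≃ₜ Circle)) : Prop :=
  IsPseudoFibered G ∧ (∃ g ∈ G, IsHyperbolic g) ∧ ∃ g ∈ G, IsPALike g

/-- The product of two hyperbolic elements is hyperbolic, unless it is the identity (as for
`g * g⁻¹`). -/
def IsTame (G : Subgroup (Circle ≃ₜ Circle)) : Prop :=
  ∀ g ∈ G, ∀ h ∈ G, IsHyperbolic g → IsHyperbolic h → g * h = 1 ∨ IsHyperbolic (g * h)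

/-! ### Outer automorphisms -/

/-- The inner automorphisms of `H`. -/
def Inn (H : Type*) [Group H] : Subgroup (MulAut H) := (MulAut.conj : H →* MulAut H).range

instance innNormal (H : Type*) [Group H] : (Inn H).Normal where
  conj_mem := by
    rintro _ ⟨h, rfl⟩ α
    refine ⟨α h, ?_⟩
    ext x
    simp [MulAut.conj_apply]

/-- The outer automorphism group of `H`. -/
abbrev Out (H : Type*) [Group H] : Type _ := MulAut H ⧸ Inn H

/-- The action of automorphisms on conjugacy classes, `[h] ↦ [α h]`. -/
def autOnClasses (H : Type*) [Group H] : MulAut H →* Equiv.Perm (ConjClasses H) where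
  toFun α :=
    { toFun := ConjClasses.map α.toMonoidHom
      invFun := ConjClasses.map (α⁻¹ : MulAut H).toMonoidHom
      left_inv := by
        rintro ⟨h⟩
        exact congrArg ConjClasses.mk (α.symm_apply_apply h)
      right_inv := by
        rintro ⟨h⟩
        exact congrArg ConjClasses.mk (α.apply_symm_apply h) }
  map_one' := by
    ext ⟨h⟩
    rfl
  map_mul' := by
    intro α β
    ext ⟨h⟩
    rfl

/-- The induced action of the outer automorphism group on conjugacy classes. -/
def outOnClasses (H : Type*) [Group H] : Out H →* Equiv.Perm (ConjClasses H) :=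
  QuotientGroup.lift (Inn H) (autOnClasses H) (by
    rintro _ ⟨h, rfl⟩
    ext ⟨x⟩
    exact ConjClasses.mk_eq_mk_iff_isConj.mpr (isConj_iff.mpr ⟨h⁻¹, by simp [mul_assoc]⟩))

end CircleLam

open CircleLam

/-!
Tameness makes the hyperbolic elements, together with the identity, a subgroup `H`. If `φ ^ n` maps
the `H`-conjugacy class of a hyperbolic `h` to itself, then some `k * φ ^ n` with `k ∈ H` commutes
with `h`. The centralizer of a hyperbolic element consists of the identity and hyperbolic elements
(`IsPseudoFibered.isHyperbolic_of_commute`), so `φ ^ n` lies in `H`; as `φ` commutes with `φ ^ n`,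
the same fact makes `φ` hyperbolic or a torsion element, and neither is pseudo-Anosov-like
(`IsPALike.pow_not_hyperbolic`). In particular conjugation by `φ` is not inner on `H`.

The statement on centralizers rests on two facts about a nontrivial `g` in the group.

* `g` has finitely many fixed points (`finite_Fix`). A point that is not an endpoint of a very full
  lamination is enclosed by arbitrarily short leaves (`Lamination.IsVeryFull.exists_rainbow`).
  Iterating `g` on such a leaf around an isolated fixed point that is not an endpoint shows that the
  two neighbouring fixed points span a leaf (`isLeaf_neighbours`). Endpoints of one lamination are not endpoints of the
  other, so along an infinite chain of isolated fixed points the leaves of the two laminations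
  alternate, each joining a fixed point to the next but one. A leaf around the limit of the chain
  converges to a third leaf at some point of the chain (`not_accumulating_at_pi`), but in a loose
  lamination at most two leaves meet at a point (`Lamination.IsLoose.eq_of_three_leaves`).
* If `g` has exactly two fixed points, then it is hyperbolic (`isHyperbolic_of_Fix_eq_pair`), again
  by iterating `g` on a short leaf around a fixed point.

If `g` commutes with a hyperbolic `h`, it fixes the attracting and the repelling point of `h`
separately, and its finite fixed point set is invariant under `h`; points with a finite `h`-orbit
are fixed by `h`, so `g` has the same two fixed points as `h`.

Computations take place in an angular coordinate whose base point is fixed, where a homeomorphism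
becomes an order automorphism of `ℝ` (`IsLift`).
-/

namespace CircleLam

open Complex Topology Set Filter

/-! ### Signed area and chords -/

/-- Twice the signed area of the triangle `a b z`; `Ccw a b c` says that it is positive. -/
def area (a b z : ℂ) : ℝ := ((starRingEnd ℂ) (b - a) * (z - a)).im

theorem ccw_iff {a b c : Circle} : Ccw a b c ↔ 0 < area a b c := Iff.rfl

theorem area_eq (a b z : ℂ) :
    area a b z = (b.re - a.re) * (z.im - a.im) - (b.im - a.im) * (z.re - a.re) := by
  simp [area, Complex.mul_im]; ring

theorem area_swap_right (a b c : ℂ) : area a c b = - area a b c := by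
  simp only [area_eq]; ring

theorem area_rotate (a b c : ℂ) : area b c a = area a b c := by
  simp only [area_eq]; ring

theorem continuous_area (a b : ℂ) : Continuous (area a b) := by
  unfold area; fun_prop

theorem area_lineCombination (a b x y : ℂ) {s t : ℝ} (h : s + t = 1) :
    area a b (s • x + t • y) = s * area a b x + t * area a b y := by
  obtain rfl : s = 1 - t := by linarith
  simp only [area_eq]
  simp
  ring

theorem convex_area_nonneg (a b : ℂ) : Convex ℝ {z | 0 ≤ area a b z} := by
  intro x hx y hy s t hs ht hst
  simp only [mem_ofPred_eq] at *
  rw [area_lineCombination a b x y hst]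
  positivity

theorem circle_re_sq_add_im_sq (a : Circle) : (a : ℂ).re ^ 2 + (a : ℂ).im ^ 2 = 1 := by
  have h := Circle.normSq_coe a
  rw [Complex.normSq_apply] at h
  linarith

theorem circle_eq_of_sq_add_sq_nonpos {a b : Circle}
    (h : ((b : ℂ).re - (a : ℂ).re) ^ 2 + ((b : ℂ).im - (a : ℂ).im) ^ 2 ≤ 0) : a = b := by
  have h1 : (b : ℂ).re - (a : ℂ).re = 0 := by
    nlinarith [sq_nonneg ((b : ℂ).im - (a : ℂ).im), sq_nonneg ((b : ℂ).re - (a : ℂ).re)]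
  have h2 : (b : ℂ).im - (a : ℂ).im = 0 := by
    nlinarith [sq_nonneg ((b : ℂ).im - (a : ℂ).im), sq_nonneg ((b : ℂ).re - (a : ℂ).re)]
  exact Circle.ext (Complex.ext (by linarith) (by linarith))

theorem area_eq_zero_of_mem_segment {a b z : ℂ} (h : z ∈ segment ℝ a b) : area a b z = 0 := by
  obtain ⟨s, t, -, -, hst, rfl⟩ := h
  rw [area_lineCombination a b a b hst]
  simp only [area_eq]; ring

/-- A chord is the whole intersection of its line with the closed disk. -/
theorem mem_segment_of_area_eq_zero {a b : Circle} (hab : a ≠ b) {z : ℂ} (hz : ‖z‖ ≤ 1)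
    (h : area a b z = 0) : z ∈ segment ℝ (a : ℂ) (b : ℂ) := by
  have ha := circle_re_sq_add_im_sq a
  have hb := circle_re_sq_add_im_sq b
  have hz' : z.re ^ 2 + z.im ^ 2 ≤ 1 := by
    have h1 := Complex.sq_norm z
    rw [Complex.normSq_apply] at h1
    nlinarith [norm_nonneg z]
  rw [area_eq] at h
  set d : ℝ := ((b : ℂ).re - (a : ℂ).re) ^ 2 + ((b : ℂ).im - (a : ℂ).im) ^ 2 with hd
  have hdpos : 0 < d := lt_of_not_ge fun h => hab (circle_eq_of_sq_add_sq_nonpos h)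
  set t : ℝ := (((b : ℂ).re - (a : ℂ).re) * (z.re - (a : ℂ).re) +
    ((b : ℂ).im - (a : ℂ).im) * (z.im - (a : ℂ).im)) / d with ht
  have htd : t * d = ((b : ℂ).re - (a : ℂ).re) * (z.re - (a : ℂ).re) +
    ((b : ℂ).im - (a : ℂ).im) * (z.im - (a : ℂ).im) := by
    rw [ht]; field_simp
  have hre : z.re = (a : ℂ).re + t * ((b : ℂ).re - (a : ℂ).re) := by
    apply mul_left_cancel₀ hdpos.ne'
    linear_combination (-((b : ℂ).re - (a : ℂ).re)) * htd + (z.re - (a : ℂ).re) * hd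
      - ((b : ℂ).im - (a : ℂ).im) * h
  have him : z.im = (a : ℂ).im + t * ((b : ℂ).im - (a : ℂ).im) := by
    apply mul_left_cancel₀ hdpos.ne'
    linear_combination (-((b : ℂ).im - (a : ℂ).im)) * htd + (z.im - (a : ℂ).im) * hd
      + ((b : ℂ).re - (a : ℂ).re) * h
  -- the squared norm of `a + t (b - a)` is `1 + (t ^ 2 - t) |b - a| ^ 2`
  have key : (t ^ 2 - t) * d ≤ 0 := by
    have : (t ^ 2 - t) * d = z.re ^ 2 + z.im ^ 2 - 1 := by
      rw [hre, him, hd]; linear_combination (t - 1) * ha - t * hb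
    linarith
  have ht2 : t ^ 2 - t ≤ 0 := by
    by_contra hcon
    push Not at hcon
    nlinarith
  have ht0 : 0 ≤ t := by nlinarith
  have ht1 : t ≤ 1 := by nlinarith
  refine ⟨1 - t, t, by linarith, ht0, by ring, ?_⟩
  apply Complex.ext
  · simp [hre]; ring
  · simp [him]; ring

/-- Points of the circle are extreme in the closed disk. -/
theorem eq_or_eq_of_mem_segment {a b p : Circle} (h : (p : ℂ) ∈ segment ℝ (a : ℂ) (b : ℂ)) :
    p = a ∨ p = b := by
  obtain ⟨s, t, hs, ht, hst, h⟩ := h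
  have ha := circle_re_sq_add_im_sq a
  have hb := circle_re_sq_add_im_sq b
  have hp := circle_re_sq_add_im_sq p
  have hre : (p : ℂ).re = s * (a : ℂ).re + t * (b : ℂ).re := by rw [← h]; simp
  have him : (p : ℂ).im = s * (a : ℂ).im + t * (b : ℂ).im := by rw [← h]; simp
  obtain rfl : s = 1 - t := by linarith
  have key : t * (1 - t) * (((b : ℂ).re - (a : ℂ).re) ^ 2 + ((b : ℂ).im - (a : ℂ).im) ^ 2) = 0 := by
    rw [hre, him] at hp
    linear_combination (1 - t) * ha + t * hb - hp
  rcases mul_eq_zero.1 key with h1 | h1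
  · rcases mul_eq_zero.1 h1 with h2 | h2
    · left; exact Circle.ext (Complex.ext (by rw [hre, h2]; ring) (by rw [him, h2]; ring))
    · right
      have h3 : t = 1 := by linarith
      exact Circle.ext (Complex.ext (by rw [hre, h3]; ring) (by rw [him, h3]; ring))
  · left
    obtain rfl := circle_eq_of_sq_add_sq_nonpos h1.le
    exact Circle.ext (Complex.ext (by rw [hre]; ring) (by rw [him]; ring))

/-- The signed area of an inscribed triangle in terms of the angles of its vertices. -/
theorem area_mul_exp (c : Circle) (s t u : ℝ) :
    area ((c * Circle.exp s : Circle) : ℂ) ((c * Circle.exp t : Circle) : ℂ)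
      ((c * Circle.exp u : Circle) : ℂ) =
      4 * Real.sin ((t - s) / 2) * Real.sin ((u - s) / 2) * Real.sin ((u - t) / 2) := by
  have hc := circle_re_sq_add_im_sq c
  have h1 : area ((c * Circle.exp s : Circle) : ℂ) ((c * Circle.exp t : Circle) : ℂ)
      ((c * Circle.exp u : Circle) : ℂ) =
      (Real.cos t - Real.cos s) * (Real.sin u - Real.sin s) -
        (Real.sin t - Real.sin s) * (Real.cos u - Real.cos s) := by
    simp only [area_eq, Circle.coe_mul, Circle.coe_exp, Complex.mul_re, Complex.mul_im,
      Complex.exp_ofReal_mul_I_re, Complex.exp_ofReal_mul_I_im]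
    linear_combination ((Real.cos t - Real.cos s) * (Real.sin u - Real.sin s) -
        (Real.sin t - Real.sin s) * (Real.cos u - Real.cos s)) * hc
  rw [h1, Real.cos_sub_cos, Real.sin_sub_sin, Real.sin_sub_sin, Real.cos_sub_cos]
  have h2 : Real.sin ((u - t) / 2) = Real.sin ((u + s) / 2) * Real.cos ((t + s) / 2) -
      Real.cos ((u + s) / 2) * Real.sin ((t + s) / 2) := by
    rw [← Real.sin_sub]; ring_nf
  rw [h2]; ring

/-! ### Leaves, chords and gaps -/

namespace Lamination

variable {L : Lamination}

theorem IsLeaf.ne {a b : Circle} (h : L.IsLeaf a b) : a ≠ b := h.1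

theorem IsLeaf.symm {a b : Circle} (h : L.IsLeaf a b) : L.IsLeaf b a :=
  ⟨h.1.symm, L.symm _ h.2⟩

theorem IsLeaf.mem_endpoints {a b : Circle} (h : L.IsLeaf a b) : a ∈ L.endpoints := ⟨b, h⟩

theorem isLeaf_of_tendsto {ι : Type*} {l : Filter ι} [l.NeBot] {u v : ι → Circle} {a b : Circle}
    (hu : Tendsto u l (𝓝 a)) (hv : Tendsto v l (𝓝 b)) (hab : a ≠ b)
    (h : ∀ᶠ i in l, L.IsLeaf (u i) (v i)) : L.IsLeaf a b := by
  refine ⟨hab, ?_⟩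
  have hemb : IsEmbedding (Subtype.val : {q : Circle × Circle // q.1 ≠ q.2} → Circle × Circle) :=
    IsEmbedding.subtypeVal
  classical
  have hlim : Tendsto (fun i => if h : u i ≠ v i then
      (⟨(u i, v i), h⟩ : {q : Circle × Circle // q.1 ≠ q.2}) else ⟨(a, b), hab⟩) l
      (𝓝 ⟨(a, b), hab⟩) := by
    rw [hemb.tendsto_nhds_iff]
    refine (hu.prodMk_nhds hv).congr' ?_
    filter_upwards [h] with i hi
    simp [hi.ne]
  refine L.closed.mem_of_tendsto hlim ?_
  filter_upwards [h] with i hi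
  simp only [ne_eq, hi.ne, not_false_eq_true, dif_pos]
  exact hi.2

/-- The leaves together with the degenerate pairs form a closed set. -/
theorem isClosed_eq_or_isLeaf (L : Lamination) :
    IsClosed {q : Circle × Circle | q.1 = q.2 ∨ L.IsLeaf q.1 q.2} := by
  refine isClosed_of_closure_subset fun q hq => ?_
  obtain ⟨x, hx, hlim⟩ := mem_closure_iff_seq_limit.1 hq
  by_cases hne : q.1 = q.2
  · exact Or.inl hne
  right
  have h1 : Tendsto (fun n => (x n).1) atTop (𝓝 q.1) := (continuous_fst.tendsto q).comp hlim
  have h2 : Tendsto (fun n => (x n).2) atTop (𝓝 q.2) := (continuous_snd.tendsto q).comp hlim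
  refine isLeaf_of_tendsto h1 h2 hne ?_
  have h3 : ∀ᶠ n in atTop, (x n).1 ≠ (x n).2 :=
    (h1.prodMk_nhds h2).eventually ((isOpen_ne_fun continuous_fst continuous_snd).mem_nhds hne)
  filter_upwards [h3] with n hn
  exact (hx n).resolve_left hn

/-- The chords together with the unit circle form a closed set. -/
theorem isClosed_chords_union_sphere (L : Lamination) :
    IsClosed (L.chords ∪ Metric.sphere (0 : ℂ) 1) := by
  have hK : IsCompact ({q : Circle × Circle | q.1 = q.2 ∨ L.IsLeaf q.1 q.2} ×ˢ Icc (0 : ℝ) 1) :=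
    L.isClosed_eq_or_isLeaf.isCompact.prod isCompact_Icc
  have himg := (hK.image (f := fun x : (Circle × Circle) × ℝ =>
    (1 - x.2) • (x.1.1 : ℂ) + x.2 • (x.1.2 : ℂ)) (by fun_prop)).isClosed
  convert himg using 1
  ext z
  constructor
  · rintro (⟨a, b, hab, hz⟩ | hz)
    · obtain ⟨s, t, hs, ht, hst, rfl⟩ := hz
      refine ⟨((a, b), t), ⟨Or.inr hab, ht, by linarith⟩, ?_⟩
      simp [← hst]
    · have hz' : z ∈ Submonoid.unitSphere ℂ := by simpa [Submonoid.unitSphere] using hz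
      exact ⟨((⟨z, hz'⟩, ⟨z, hz'⟩), 0), ⟨Or.inl rfl, by simp⟩, by simp⟩
  · rintro ⟨⟨⟨a, b⟩, t⟩, ⟨h | h, ht⟩, rfl⟩
    · right
      obtain rfl : a = b := h
      simp [← add_mul, Circle.norm_coe]
    · left
      exact ⟨a, b, h, 1 - t, t, by linarith [ht.2], ht.1, by ring, rfl⟩

theorem isOpen_complement (L : Lamination) : IsOpen L.complement := by
  have : L.complement = Metric.ball 0 1 ∩ (L.chords ∪ Metric.sphere (0 : ℂ) 1)ᶜ := by
    ext z
    simp only [complement, Set.mem_sdiff, mem_inter_iff, mem_compl_iff, mem_union, not_or]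
    refine ⟨fun h => ⟨h.1, h.2, fun h' => ?_⟩, fun h => ⟨h.1, h.2.1⟩⟩
    have := h.1
    simp at this h'
    linarith
  rw [this]
  exact Metric.isOpen_ball.inter L.isClosed_chords_union_sphere.isOpen_compl

/-- A gap lies on one side of each leaf. -/
theorem IsGap.area_nonneg_or_nonpos {P : Set ℂ} (hP : L.IsGap P) {c d : Circle}
    (hcd : L.IsLeaf c d) : (∀ z ∈ P, 0 ≤ area c d z) ∨ (∀ z ∈ P, area c d z ≤ 0) := by
  obtain ⟨z₀, hz₀, rfl⟩ := hP
  have hne : ∀ z ∈ connectedComponentIn L.complement z₀, area c d z ≠ 0 := by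
    intro z hz h0
    have hz' := connectedComponentIn_subset _ _ hz
    refine hz'.2 ⟨c, d, hcd, mem_segment_of_area_eq_zero hcd.ne ?_ h0⟩
    have := hz'.1
    simp at this
    exact this.le
  have hcl1 : IsClosed {z | 0 ≤ area c d z} := isClosed_le continuous_const (continuous_area _ _)
  have hcl2 : IsClosed {z | area c d z ≤ 0} := isClosed_le (continuous_area _ _) continuous_const
  have hpre := isPreconnected_connectedComponentIn (F := L.complement) (x := z₀)
  by_cases h : ∃ x ∈ connectedComponentIn L.complement z₀, 0 < area c d x
  · obtain ⟨x, hx, hx0⟩ := h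
    left
    refine fun z hz => hcl1.closure_subset_iff.2 (fun y hy => ?_) hz
    change 0 ≤ area c d y
    by_contra hy0
    push Not at hy0
    obtain ⟨w, hw, hw0⟩ := hpre.intermediate_value hy hx (continuous_area c d).continuousOn
      ⟨hy0.le, hx0.le⟩
    exact hne w hw hw0
  · push Not at h
    right
    exact fun z hz => hcl2.closure_subset_iff.2 h hz

theorem IsEdge.mem {P : Set ℂ} {a b : Circle} (h : L.IsEdge a b P) : (a : ℂ) ∈ P ∧ (b : ℂ) ∈ P := by
  obtain ⟨⟨z, -, rfl⟩, -, hf⟩ := h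
  have := hf.trans isClosed_closure.frontier_subset
  exact ⟨this (left_mem_segment _ _ _), this (right_mem_segment _ _ _)⟩

/-- If the leaf `x b` separates `a` from `c`, then `x a` and `x c` are not edges of one gap. -/
theorem IsLoose.not_separated (hL : L.IsLoose) {x a b c : Circle} (ha : L.IsLeaf x a)
    (hb : L.IsLeaf x b) (hc : L.IsLeaf x c) (h1 : Ccw x a b) (h2 : Ccw x b c) : False := by
  rw [ccw_iff] at h1 h2
  have hac : a ≠ c := by
    rintro rfl
    rw [area_swap_right] at h1
    linarith
  obtain ⟨P, hPa, hPc⟩ := hL x a c ha hc hac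
  rw [area_swap_right] at h1
  rcases hPa.1.area_nonneg_or_nonpos hb with h | h
  · linarith [h _ hPa.mem.2]
  · linarith [h _ hPc.mem.2]

end Lamination

/-! ### Angular coordinates -/

theorem ccw_mul_exp {c : Circle} {s t u : ℝ} (hst : s < t) (htu : t < u)
    (hus : u < s + 2 * Real.pi) :
    Ccw (c * Circle.exp s) (c * Circle.exp t) (c * Circle.exp u) := by
  rw [ccw_iff, area_mul_exp]
  have h1 : 0 < Real.sin ((t - s) / 2) := Real.sin_pos_of_pos_of_lt_pi (by linarith) (by linarith)
  have h2 : 0 < Real.sin ((u - s) / 2) := Real.sin_pos_of_pos_of_lt_pi (by linarith) (by linarith)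
  have h3 : 0 < Real.sin ((u - t) / 2) := Real.sin_pos_of_pos_of_lt_pi (by linarith) (by linarith)
  positivity


theorem exists_mul_exp (c x : Circle) : ∃ t ∈ Ioc (-Real.pi) Real.pi, c * Circle.exp t = x :=
  ⟨Complex.arg (c⁻¹ * x : Circle), ⟨Complex.neg_pi_lt_arg _, Complex.arg_le_pi _⟩, by
    rw [Circle.exp_arg]; simp⟩

theorem mul_exp_pi (c : Circle) : c * Circle.exp Real.pi = c * Circle.exp (-Real.pi) := by
  congr 1
  apply Circle.ext
  simp [Circle.coe_exp]

/-- Every point other than the base point `x` has a unique angle in `(-π, π)`, where `x` itself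
has the angle `±π`. -/
theorem exists_base (x : Circle) : ∃ c : Circle, c * Circle.exp Real.pi = x ∧
    ∀ y, y ≠ x → ∃ t ∈ Ioo (-Real.pi) Real.pi, c * Circle.exp t = y := by
  refine ⟨x * (Circle.exp Real.pi)⁻¹, by simp, fun y hy => ?_⟩
  obtain ⟨t, ht, h⟩ := exists_mul_exp (x * (Circle.exp Real.pi)⁻¹) y
  refine ⟨t, ⟨ht.1, lt_of_le_of_ne ht.2 ?_⟩, h⟩
  rintro rfl
  exact hy (by rw [← h]; simp)

namespace Lamination

/-- In a loose lamination at most two leaves end at a point: of three leaves the middle one would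
cut through the gap that has the outer two as edges. -/
theorem IsLoose.eq_of_three_leaves {L : Lamination} (hL : L.IsLoose) {x a b c : Circle}
    (ha : L.IsLeaf x a) (hb : L.IsLeaf x b) (hc : L.IsLeaf x c) (hab : a ≠ b) (hbc : b ≠ c)
    (hac : a ≠ c) : False := by
  obtain ⟨o, rfl, ho⟩ := exists_base x
  obtain ⟨s, hs, rfl⟩ := ho a ha.ne.symm
  obtain ⟨t, ht, rfl⟩ := ho b hb.ne.symm
  obtain ⟨u, hu, rfl⟩ := ho c hc.ne.symm
  have key : ∀ s ∈ Ioo (-Real.pi) Real.pi, ∀ t ∈ Ioo (-Real.pi) Real.pi, s < t →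
      Ccw (o * Circle.exp Real.pi) (o * Circle.exp s) (o * Circle.exp t) := by
    intro s hs t ht hst
    rw [mul_exp_pi]
    exact ccw_mul_exp hs.1 hst (by linarith [ht.2])
  have hab' : s ≠ t := fun h => hab (by rw [h])
  have hbc' : t ≠ u := fun h => hbc (by rw [h])
  have hac' : s ≠ u := fun h => hac (by rw [h])
  rcases lt_or_gt_of_ne hab' with h1 | h1 <;> rcases lt_or_gt_of_ne hbc' with h2 | h2 <;>
    rcases lt_or_gt_of_ne hac' with h3 | h3
  · exact hL.not_separated ha hb hc (key _ hs _ ht h1) (key _ ht _ hu h2)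
  · linarith
  · exact hL.not_separated ha hc hb (key _ hs _ hu h3) (key _ hu _ ht h2)
  · exact hL.not_separated hc ha hb (key _ hu _ hs h3) (key _ hs _ ht h1)
  · exact hL.not_separated hb ha hc (key _ ht _ hs h1) (key _ hs _ hu h3)
  · exact hL.not_separated hb hc ha (key _ ht _ hu h2) (key _ hu _ hs h3)
  · linarith
  · exact hL.not_separated hc hb ha (key _ hu _ ht h2) (key _ ht _ hs h1)

end Lamination

/-! ### Rainbows -/

theorem add_div_two_mem_ball {p q : Circle} (hpq : p ≠ q) :
    (((p : ℂ) + q) / 2) ∈ Metric.ball (0 : ℂ) 1 := by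
  have h1 := circle_re_sq_add_im_sq p
  have h2 := circle_re_sq_add_im_sq q
  rw [mem_ball_zero_iff]
  by_contra hcon
  push Not at hcon
  have h3 : 1 ≤ ‖((p : ℂ) + q) / 2‖ ^ 2 := by nlinarith
  rw [Complex.sq_norm, Complex.normSq_apply] at h3
  simp at h3
  exact hpq (circle_eq_of_sq_add_sq_nonpos (by linarith)).symm

/-- A finite subset of the circle lies on one closed side of the chord from a point `p` to the
next point `q` of the set in the counterclockwise direction. -/
theorem exists_successor {F : Finset Circle} {p : Circle} (hF : 2 ≤ F.card) :
    ∃ q ∈ F, p ≠ q ∧ ∀ x ∈ F, 0 ≤ area p q x := by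
  classical
  obtain ⟨c, hc, hx⟩ := exists_base p
  have hne : (F.erase p).Nonempty := by
    rw [← Finset.card_pos]
    have := Finset.pred_card_le_card_erase (s := F) (a := p)
    omega
  choose! θ hθ hθ' using hx
  obtain ⟨q, hq, hmin⟩ := Finset.exists_min_image (F.erase p) θ hne
  have hqp := Finset.ne_of_mem_erase hq
  refine ⟨q, Finset.mem_of_mem_erase hq, hqp.symm, fun x hxF => ?_⟩
  by_cases hxp : x = p
  · rw [hxp, area_eq]; ring_nf; exact le_rfl
  have hle := hmin x (Finset.mem_erase.2 ⟨hxp, hxF⟩)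
  rcases hle.eq_or_lt with h | h
  · have : x = q := by rw [← hθ' x hxp, ← hθ' q hqp, h]
    rw [this, area_eq]; ring_nf; exact le_rfl
  · have := ccw_mul_exp (c := c) (hθ q hqp).1 h (by linarith [(hθ x hxp).2])
    rw [← mul_exp_pi, hc, hθ' q hqp, hθ' x hxp, ccw_iff] at this
    exact this.le

namespace Lamination

variable {L : Lamination}

/-- The ideal vertices of a polygonal gap are endpoints of leaves: the midpoint of a side must lie
on a leaf, and a leaf that does not cut through the gap contains the side. -/
theorem IsVeryFull.mem_endpoints (hL : L.IsVeryFull) {P : Set ℂ} (hP : L.IsGap P) {p : Circle}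
    (hp : (p : ℂ) ∈ P) : p ∈ L.endpoints := by
  obtain ⟨F, hF, hPF⟩ := hL P hP
  obtain ⟨q, hqF, hpq, hside⟩ := exists_successor (F := F) (p := p) (by omega)
  have hq : (q : ℂ) ∈ P := by
    rw [hPF]; exact subset_convexHull _ _ ⟨q, hqF, rfl⟩
  have hPside : ∀ z ∈ P, 0 ≤ area p q z := by
    rw [hPF]
    refine fun z hz => convexHull_min ?_ (convex_area_nonneg (p : ℂ) q) hz
    rintro _ ⟨x, hx, rfl⟩
    exact hside x hx
  set w : ℂ := ((p : ℂ) + q) / 2 with hw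
  have hw_eq : w = (1 / 2 : ℝ) • (p : ℂ) + (1 / 2 : ℝ) • (q : ℂ) := by
    rw [hw]; simp; ring
  have hwP : w ∈ P := by
    have hconv : Convex ℝ P := by rw [hPF]; exact convex_convexHull _ _
    rw [hw_eq]
    exact hconv hp hq (by norm_num) (by norm_num) (by norm_num)
  have hwball := add_div_two_mem_ball hpq
  have hwch : w ∈ L.chords := by
    by_contra hnot
    obtain ⟨z₀, hz₀, rfl⟩ := hP
    have hwc : w ∈ L.complement := ⟨hwball, hnot⟩
    obtain ⟨r, hr, hball⟩ := Metric.isOpen_iff.1 L.isOpen_complement w hwc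
    obtain ⟨y, hy, hyr⟩ := Metric.mem_closure_iff.1 hwP r hr
    have hyb : y ∈ Metric.ball w r := by rwa [Metric.mem_ball, dist_comm]
    have hsub : Metric.ball w r ⊆ connectedComponentIn L.complement z₀ := by
      have := (convex_ball w r).isPreconnected.subset_connectedComponentIn hyb hball
      rwa [← connectedComponentIn_eq hy] at this
    -- a point of the ball on the far side of the line through `p` and `q`
    set v : ℂ := -I * ((q : ℂ) - p) with hv
    have hvpos : 0 < ‖v‖ := by
      rw [norm_pos_iff, hv]
      refine mul_ne_zero (by simp) (sub_ne_zero.2 fun h => hpq (Circle.ext h.symm))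
    have hmem : w + ((r / (2 * ‖v‖) : ℝ) : ℂ) * v ∈ Metric.ball w r := by
      rw [mem_ball_iff_norm, add_sub_cancel_left, norm_mul, Complex.norm_real, Real.norm_eq_abs,
        abs_of_pos (by positivity)]
      field_simp
      linarith
    have h1 := hPside _ (subset_closure (hsub hmem))
    have h2 : ∀ k : ℝ, area p q (w + (k : ℂ) * v) = -k * ‖v‖ ^ 2 := by
      intro k
      rw [Complex.sq_norm, Complex.normSq_apply, area_eq, hv, hw]
      simp
      ring
    rw [h2] at h1
    have : 0 < (r / (2 * ‖v‖)) * ‖v‖ ^ 2 := by positivity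
    linarith
  obtain ⟨c, d, hcd, hwcd⟩ := hwch
  have hsum : (1 / 2 : ℝ) * area c d p + (1 / 2 : ℝ) * area c d q = 0 := by
    rw [← area_lineCombination _ _ _ _ (by norm_num), ← hw_eq]
    exact area_eq_zero_of_mem_segment hwcd
  have hzero : area c d p = 0 := by
    rcases hP.area_nonneg_or_nonpos hcd with h | h
    · linarith [h _ hp, h _ hq]
    · linarith [h _ hp, h _ hq]
  rcases eq_or_eq_of_mem_segment
    (mem_segment_of_area_eq_zero hcd.ne (Circle.norm_coe p).le hzero) with rfl | rfl
  · exact hcd.mem_endpoints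
  · exact hcd.symm.mem_endpoints

/-- If `p` is not an endpoint, then the radius towards `p` meets leaves arbitrarily close to `p`:
otherwise its end lies in a single gap, which has `p` as an ideal vertex. -/
theorem IsVeryFull.exists_smul_mem_chords (hL : L.IsVeryFull) {p : Circle} (hp : p ∉ L.endpoints)
    {t₀ : ℝ} (h0 : 0 ≤ t₀) (h1 : t₀ < 1) : ∃ t ∈ Ioo t₀ 1, t • (p : ℂ) ∈ L.chords := by
  by_contra hcon
  push Not at hcon
  have hsub : (fun t : ℝ => t • (p : ℂ)) '' Ioo t₀ 1 ⊆ L.complement := by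
    rintro _ ⟨t, ht, rfl⟩
    refine ⟨?_, hcon t ht⟩
    rw [mem_ball_zero_iff, norm_smul, Circle.norm_coe, mul_one, Real.norm_eq_abs,
      abs_of_pos (h0.trans_lt ht.1)]
    exact ht.2
  have hpre : IsPreconnected ((fun t : ℝ => t • (p : ℂ)) '' Ioo t₀ 1) :=
    isPreconnected_Ioo.image _ (by fun_prop)
  have hmid : (t₀ + 1) / 2 ∈ Ioo t₀ 1 := ⟨by linarith, by linarith⟩
  have hin := hpre.subset_connectedComponentIn (mem_image_of_mem _ hmid) hsub
  refine hp (hL.mem_endpoints ⟨_, hsub (mem_image_of_mem _ hmid), rfl⟩ ?_)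
  refine closure_mono hin (?_ : (p : ℂ) ∈ _)
  have hcl : (1 : ℝ) ∈ closure (Ioo t₀ 1) := by
    rw [closure_Ioo h1.ne]; exact ⟨h1.le, le_rfl⟩
  have := image_closure_subset_closure_image (f := fun t : ℝ => t • (p : ℂ))
    (s := Ioo t₀ 1) (by fun_prop) (mem_image_of_mem _ hcl)
  simpa using this

/-- A point that is not an endpoint of a very full lamination is enclosed by arbitrarily short
leaves. -/
theorem IsVeryFull.exists_rainbow (hL : L.IsVeryFull) {p : Circle} (hp : p ∉ L.endpoints)
    {ε : ℝ} (hε : 0 < ε) : ∃ s ∈ Ioo 0 ε, ∃ t ∈ Ioo 0 ε,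
      L.IsLeaf (p * Circle.exp (-s)) (p * Circle.exp t) := by
  have hseq : ∀ n : ℕ, ∃ t ∈ Ioo (1 - 1 / ((n : ℝ) + 1)) 1, t • (p : ℂ) ∈ L.chords := by
    intro n
    refine hL.exists_smul_mem_chords hp ?_ ?_
    · have : 1 / ((n : ℝ) + 1) ≤ 1 := by
        rw [div_le_one (by positivity)]; linarith [n.cast_nonneg (α := ℝ)]
      linarith
    · have : 0 < 1 / ((n : ℝ) + 1) := by positivity
      linarith
  choose r hr u v huv hseg using hseq
  have hrlim : Tendsto r atTop (𝓝 1) := by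
    have h1 : Tendsto (fun n : ℕ => 1 - 1 / ((n : ℝ) + 1)) atTop (𝓝 (1 - 0)) :=
      tendsto_const_nhds.sub tendsto_one_div_add_atTop_nhds_zero_nat
    rw [sub_zero] at h1
    exact tendsto_of_tendsto_of_tendsto_of_le_of_le h1 tendsto_const_nhds
      (fun n => (hr n).1.le) (fun n => (hr n).2.le)
  have hseg' : ∀ n, ∃ l ∈ Icc (0 : ℝ) 1, r n • (p : ℂ) = (1 - l) • (u n : ℂ) + l • (v n : ℂ) := by
    intro n
    obtain ⟨a, b, ha, hb, hab, h⟩ := hseg n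
    exact ⟨b, ⟨hb, by linarith⟩, by rw [← h, ← hab, add_sub_cancel_right]⟩
  choose l hl hseg' using hseg'
  obtain ⟨⟨⟨a, b⟩, m⟩, hm, φ, hφ, hlim⟩ :=
    ((isCompact_univ (X := Circle × Circle)).prod
      (isCompact_Icc (a := (0 : ℝ)) (b := 1))).tendsto_subseq (x := fun n => ((u n, v n), l n))
      (fun n => ⟨mem_univ _, hl n⟩)
  have hu : Tendsto (u ∘ φ) atTop (𝓝 a) :=
    ((continuous_fst.comp continuous_fst).tendsto _).comp hlim
  have hv : Tendsto (v ∘ φ) atTop (𝓝 b) :=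
    ((continuous_snd.comp continuous_fst).tendsto _).comp hlim
  have hl' : Tendsto (l ∘ φ) atTop (𝓝 m) := (continuous_snd.tendsto _).comp hlim
  have hpseg : (p : ℂ) = (1 - m) • (a : ℂ) + m • (b : ℂ) := by
    have e1 : Tendsto (fun n => r (φ n) • (p : ℂ)) atTop (𝓝 ((1 : ℝ) • (p : ℂ))) :=
      (hrlim.comp hφ.tendsto_atTop).smul tendsto_const_nhds
    have e2 : Tendsto (fun n => (1 - l (φ n)) • (u (φ n) : ℂ) + l (φ n) • (v (φ n) : ℂ)) atTop
        (𝓝 ((1 - m) • (a : ℂ) + m • (b : ℂ))) :=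
      ((tendsto_const_nhds.sub hl').smul ((continuous_subtype_val.tendsto _).comp hu)).add
        (hl'.smul ((continuous_subtype_val.tendsto _).comp hv))
    rw [one_smul] at e1
    simp only [hseg'] at e1
    exact tendsto_nhds_unique e1 e2
  have hpab : p = a ∨ p = b :=
    eq_or_eq_of_mem_segment ⟨1 - m, m, by linarith [hm.2.2], hm.2.1, by ring, hpseg.symm⟩
  -- a nondegenerate limit would be a leaf ending at `p`
  have hab : a = b := by
    by_contra hab
    have hleaf := isLeaf_of_tendsto hu hv hab (Eventually.of_forall fun n => huv (φ n))
    rcases hpab with rfl | rfl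
    · exact hp hleaf.mem_endpoints
    · exact hp hleaf.symm.mem_endpoints
  have hpa : p = a := by rcases hpab with h | h <;> simp [h, hab]
  subst hab
  subst hpa
  have harg : ContinuousAt (fun x : Circle => Complex.arg (p⁻¹ * x : Circle)) p := by
    refine (Complex.continuousAt_arg ?_).comp (by fun_prop)
    simp
  have hsmall : ∀ᶠ x : Circle in 𝓝 p, |Complex.arg (p⁻¹ * x : Circle)| < min ε Real.pi := by
    have h0 : Complex.arg (p⁻¹ * p : Circle) = 0 := by simp
    have := harg.abs
    refine this.eventually_lt_const ?_
    simp only [h0, abs_zero]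
    exact lt_min hε Real.pi_pos
  obtain ⟨n, hun, hvn⟩ := ((hu.eventually hsmall).and (hv.eventually hsmall)).exists
  have key := hseg' (φ n)
  have hleaf := huv (φ n)
  have hlm := hl (φ n)
  simp only [Function.comp_apply] at hun hvn
  obtain ⟨s, hs⟩ : ∃ s, s = Complex.arg (p⁻¹ * u (φ n) : Circle) := ⟨_, rfl⟩
  obtain ⟨t, ht⟩ : ∃ t, t = Complex.arg (p⁻¹ * v (φ n) : Circle) := ⟨_, rfl⟩
  have hus : u (φ n) = p * Circle.exp s := by rw [hs, Circle.exp_arg]; simp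
  have hvt : v (φ n) = p * Circle.exp t := by rw [ht, Circle.exp_arg]; simp
  rw [← hs, abs_lt] at hun
  rw [← ht, abs_lt] at hvn
  rw [hus, hvt] at key hleaf
  -- the imaginary part after rotating `p` to `1`
  have him : (1 - l (φ n)) * Real.sin s + l (φ n) * Real.sin t = 0 := by
    have h1 := congrArg Complex.re key
    have h2 := congrArg Complex.im key
    simp only [Circle.coe_mul, Circle.coe_exp, add_re, real_smul, mul_re, ofReal_re, ofReal_im,
      zero_mul, sub_zero, add_im, mul_im, add_zero, Complex.exp_ofReal_mul_I_re,
      Complex.exp_ofReal_mul_I_im] at h1 h2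
    have h3 := circle_re_sq_add_im_sq p
    linear_combination (p : ℂ).im * h1 - (p : ℂ).re * h2 -
      ((1 - l (φ n)) * Real.sin s + l (φ n) * Real.sin t) * h3
  have hs0 : s ≠ 0 := by
    rintro rfl
    exact hp (by simpa using hleaf.mem_endpoints)
  have ht0 : t ≠ 0 := by
    rintro rfl
    exact hp (by simpa using hleaf.symm.mem_endpoints)
  have hmin1 := min_le_left ε Real.pi
  have hmin2 := min_le_right ε Real.pi
  have hpos : ∀ x y : ℝ, 0 < x → 0 < y → (1 - l (φ n)) * x + l (φ n) * y ≠ 0 := by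
    intro x y hx hy h
    rcases hlm.1.eq_or_lt with h' | h'
    · rw [← h'] at h; linarith
    · nlinarith [mul_pos h' hy, mul_nonneg (sub_nonneg.2 hlm.2) hx.le]
  rcases lt_or_gt_of_ne hs0 with h1 | h1 <;> rcases lt_or_gt_of_ne ht0 with h2 | h2
  · refine (hpos (-Real.sin s) (-Real.sin t) ?_ ?_ (by linarith)).elim
    · linarith [Real.sin_neg_of_neg_of_neg_pi_lt h1 (by linarith)]
    · linarith [Real.sin_neg_of_neg_of_neg_pi_lt h2 (by linarith)]
  · exact ⟨-s, ⟨by linarith, by linarith⟩, t, ⟨h2, by linarith⟩, by simpa using hleaf⟩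
  · exact ⟨-t, ⟨by linarith, by linarith⟩, s, ⟨h1, by linarith⟩, by simpa using hleaf.symm⟩
  · refine (hpos (Real.sin s) (Real.sin t) ?_ ?_ him).elim
    · exact Real.sin_pos_of_pos_of_lt_pi h1 (by linarith)
    · exact Real.sin_pos_of_pos_of_lt_pi h2 (by linarith)

end Lamination

/-! ### Coordinates at a fixed point -/

/-- `e` parametrizes the circle by angle, in one of the two directions. The base point is
`e π = e (-π)`; the other points correspond to `(-π, π)`. -/
def IsCoord (e : ℝ → Circle) : Prop :=
  ∃ c : Circle, (∀ t, e t = c * Circle.exp t) ∨ (∀ t, e t = c * Circle.exp (-t))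

namespace IsCoord

variable {e : ℝ → Circle}

theorem neg (he : IsCoord e) : IsCoord (fun t => e (-t)) := by
  obtain ⟨c, h | h⟩ := he
  · exact ⟨c, Or.inr fun t => h _⟩
  · exact ⟨c, Or.inl fun t => by simp [h]⟩

theorem continuous (he : IsCoord e) : Continuous e := by
  obtain ⟨c, h | h⟩ := he
  · rw [funext h]; fun_prop
  · rw [funext h]; fun_prop

theorem add_two_pi (he : IsCoord e) (t : ℝ) : e (t + 2 * Real.pi) = e t := by
  obtain ⟨c, h | h⟩ := he
  · rw [h, h, Circle.exp_add, Circle.exp_two_pi, mul_one]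
  · rw [h, h, neg_add, Circle.exp_add, Circle.exp_neg (2 * Real.pi), Circle.exp_two_pi, inv_one,
      mul_one]

theorem neg_pi (he : IsCoord e) : e (-Real.pi) = e Real.pi := by
  rw [← he.add_two_pi]; congr 1; ring

theorem ne_of_lt (he : IsCoord e) {s t : ℝ} (h1 : s < t) (h2 : t < s + 2 * Real.pi) :
    e s ≠ e t := by
  intro h
  have hexp : Circle.exp (t - s) = 1 := by
    obtain ⟨c, hc | hc⟩ := he
    · rw [hc, hc, mul_right_inj] at h
      rw [Circle.exp_sub, h, div_self']
    · rw [hc, hc, mul_right_inj] at h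
      rw [show t - s = -s - -t by ring, Circle.exp_sub, h, div_self']
  obtain ⟨n, hn⟩ := Circle.exp_eq_one.1 hexp
  have hpi := Real.pi_pos
  have h3 : (0 : ℝ) < n := by
    by_contra hcon
    push Not at hcon
    nlinarith
  have h4 : (n : ℝ) < 1 := by
    by_contra hcon
    push Not at hcon
    nlinarith
  have h3' : 0 < n := by exact_mod_cast h3
  have h4' : n < 1 := by exact_mod_cast h4
  omega

theorem injOn (he : IsCoord e) : InjOn e (Ioo (-Real.pi) Real.pi) := by
  intro s hs t ht h
  by_contra hne
  rcases lt_or_gt_of_ne hne with h1 | h1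
  · exact he.ne_of_lt h1 (by linarith [ht.2, hs.1]) h
  · exact he.ne_of_lt h1 (by linarith [hs.2, ht.1]) h.symm

theorem ne_base (he : IsCoord e) {t : ℝ} (ht : t ∈ Ioo (-Real.pi) Real.pi) : e t ≠ e Real.pi :=
  he.ne_of_lt ht.2 (by linarith [ht.1])

theorem exists_angle (he : IsCoord e) {x : Circle} (hx : x ≠ e Real.pi) :
    ∃ t ∈ Ioo (-Real.pi) Real.pi, e t = x := by
  obtain ⟨c, hc | hc⟩ := he
  · obtain ⟨t, ht, h⟩ := exists_mul_exp c x
    refine ⟨t, ⟨ht.1, lt_of_le_of_ne ht.2 ?_⟩, by rw [hc, h]⟩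
    rintro rfl
    exact hx (by rw [hc, h])
  · obtain ⟨t, ht, h⟩ := exists_mul_exp c x
    have hne : t ≠ Real.pi := by
      rintro rfl
      exact hx (by rw [hc, ← mul_exp_pi, h])
    have hlt := lt_of_le_of_ne ht.2 hne
    exact ⟨-t, ⟨by linarith, by linarith [ht.1]⟩, by rw [hc, neg_neg, h]⟩

theorem exists_rainbow (he : IsCoord e) {L : Lamination} (hL : L.IsVeryFull) {x : ℝ}
    (hx : e x ∉ L.endpoints) {y z : ℝ} (hy : y < x) (hz : x < z) :
    ∃ u ∈ Ioo y x, ∃ v ∈ Ioo x z, L.IsLeaf (e u) (e v) := by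
  have hε : 0 < min (x - y) (z - x) := lt_min (by linarith) (by linarith)
  obtain ⟨s, hs, t, ht, h⟩ := hL.exists_rainbow hx hε
  have h1 := min_le_left (x - y) (z - x)
  have h2 := min_le_right (x - y) (z - x)
  obtain ⟨c, hc | hc⟩ := he
  · refine ⟨x - s, ⟨by linarith [hs.2], by linarith [hs.1]⟩, x + t,
      ⟨by linarith [ht.1], by linarith [ht.2]⟩, ?_⟩
    rw [hc, mul_assoc, mul_assoc, ← Circle.exp_add, ← Circle.exp_add] at h
    rwa [hc, hc]
  · refine ⟨x - t, ⟨by linarith [ht.2], by linarith [ht.1]⟩, x + s,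
      ⟨by linarith [hs.1], by linarith [hs.2]⟩, ?_⟩
    rw [hc, mul_assoc, mul_assoc, ← Circle.exp_add, ← Circle.exp_add] at h
    rw [hc, hc]
    convert h.symm using 3 <;> ring

end IsCoord

/-- Coordinates with prescribed base point; `e` runs counterclockwise. -/
theorem exists_coord (p : Circle) : ∃ e : ℝ → Circle, IsCoord e ∧ e Real.pi = p ∧
    ∃ c : Circle, ∀ t, e t = c * Circle.exp t := by
  obtain ⟨c, hc, -⟩ := exists_base p
  exact ⟨fun t => c * Circle.exp t, ⟨c, Or.inl fun _ => rfl⟩, hc, c, fun _ => rfl⟩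

/-- `F` is the map `f` in the coordinates `e`, whose base point `f` fixes. Only the values of `F`
on `[-π, π]` matter. -/
structure IsLift (e : ℝ → Circle) (f : Circle ≃ₜ Circle) (F : ℝ ≃o ℝ) : Prop where
  map_pi : F Real.pi = Real.pi
  map_neg_pi : F (-Real.pi) = -Real.pi
  apply_eq : ∀ t ∈ Icc (-Real.pi) Real.pi, f (e t) = e (F t)

namespace IsLift

variable {e : ℝ → Circle} {f : Circle ≃ₜ Circle} {F : ℝ ≃o ℝ}

theorem mem_Icc (h : IsLift e f F) {t : ℝ} (ht : t ∈ Icc (-Real.pi) Real.pi) :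
    F t ∈ Icc (-Real.pi) Real.pi := by
  constructor
  · rw [← h.map_neg_pi]; exact F.monotone ht.1
  · conv_rhs => rw [← h.map_pi]
    exact F.monotone ht.2

theorem mem_Ioo (h : IsLift e f F) {t : ℝ} (ht : t ∈ Ioo (-Real.pi) Real.pi) :
    F t ∈ Ioo (-Real.pi) Real.pi := by
  constructor
  · rw [← h.map_neg_pi]; exact F.strictMono ht.1
  · conv_rhs => rw [← h.map_pi]
    exact F.strictMono ht.2

theorem fixed_iff (he : IsCoord e) (h : IsLift e f F) {t : ℝ} (ht : t ∈ Ioo (-Real.pi) Real.pi) :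
    f (e t) = e t ↔ F t = t := by
  rw [h.apply_eq t (Ioo_subset_Icc_self ht)]
  exact he.injOn.eq_iff (h.mem_Ioo ht) ht

theorem symm (h : IsLift e f F) : IsLift e f⁻¹ F.symm where
  map_pi := by rw [OrderIso.symm_apply_eq, h.map_pi]
  map_neg_pi := by rw [OrderIso.symm_apply_eq, h.map_neg_pi]
  apply_eq t ht := by
    have hmem : F.symm t ∈ Icc (-Real.pi) Real.pi := by
      constructor
      · rw [OrderIso.le_symm_apply, h.map_neg_pi]; exact ht.1
      · rw [OrderIso.symm_apply_le, h.map_pi]; exact ht.2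
    have := h.apply_eq _ hmem
    rw [F.apply_symm_apply] at this
    rw [← this]
    exact f.symm_apply_apply _

theorem neg (h : IsLift e f F) :
    ∃ F' : ℝ ≃o ℝ, IsLift (fun t => e (-t)) f F' ∧ ∀ t, F' t = -F (-t) := by
  refine ⟨((OrderIso.neg ℝ).trans F.dual).trans (OrderIso.neg ℝ).symm, ⟨?_, ?_, ?_⟩, fun t => rfl⟩
  · change - F (- Real.pi) = Real.pi
    rw [h.map_neg_pi, neg_neg]
  · change - F (- -Real.pi) = -Real.pi
    rw [neg_neg, h.map_pi]
  · intro t ht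
    change f (e (-t)) = e (- - F (-t))
    rw [neg_neg]
    exact h.apply_eq _ ⟨by linarith [ht.2], by linarith [ht.1]⟩

theorem isLeaf_iterate (h : IsLift e f F) {L : Lamination}
    (hL : ∀ a b, L.IsLeaf (f a) (f b) ↔ L.IsLeaf a b) {u v : ℝ}
    (hu : u ∈ Icc (-Real.pi) Real.pi) (hv : v ∈ Icc (-Real.pi) Real.pi)
    (huv : L.IsLeaf (e u) (e v)) (n : ℕ) : L.IsLeaf (e (F^[n] u)) (e (F^[n] v)) := by
  induction n generalizing u v with
  | zero => exact huv
  | succ n ih =>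
    rw [Function.iterate_succ_apply, Function.iterate_succ_apply]
    refine ih (h.mem_Icc hu) (h.mem_Icc hv) ?_
    rw [← h.apply_eq u hu, ← h.apply_eq v hv, hL]
    exact huv

end IsLift

theorem ccw_coord_iff {c : Circle} {s t : ℝ} (hs : s ∈ Ioo (-Real.pi) Real.pi)
    (ht : t ∈ Ioo (-Real.pi) Real.pi) :
    Ccw (c * Circle.exp Real.pi) (c * Circle.exp s) (c * Circle.exp t) ↔ s < t := by
  rw [mul_exp_pi]
  refine ⟨fun h => ?_, fun h => ccw_mul_exp hs.1 h (by linarith [ht.2])⟩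
  by_contra hcon
  push Not at hcon
  rcases hcon.eq_or_lt with rfl | h'
  · rw [ccw_iff, area_eq] at h
    ring_nf at h
    exact lt_irrefl _ h
  · have h2 := ccw_mul_exp (c := c) ht.1 h' (by linarith [hs.2])
    rw [ccw_iff] at h h2
    rw [area_swap_right] at h2
    linarith

/-- The map is lifted on `(-π, π)` and continued by the identity to an order automorphism of `ℝ`,
so that its continuity comes for free. -/
theorem exists_isLift {f : Circle ≃ₜ Circle} (hf : f ∈ HomeoPlus) {e : ℝ → Circle} {c : Circle}
    (hc : ∀ t, e t = c * Circle.exp t) (hfix : f (e Real.pi) = e Real.pi) :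
    ∃ F : ℝ ≃o ℝ, IsLift e f F := by
  classical
  have he : IsCoord e := ⟨c, Or.inl hc⟩
  have hex : ∀ t : ℝ, t ∈ Ioo (-Real.pi) Real.pi →
      ∃ s ∈ Ioo (-Real.pi) Real.pi, e s = f (e t) := by
    refine fun t ht => he.exists_angle fun h => he.ne_base ht ?_
    rw [← hfix] at h
    exact f.injective h
  choose! G hG hGe using hex
  have hccw : ∀ s ∈ Ioo (-Real.pi) Real.pi, ∀ t ∈ Ioo (-Real.pi) Real.pi,
      (Ccw (e Real.pi) (e s) (e t) ↔ s < t) := by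
    intro s hs t ht
    rw [hc, hc, hc]
    exact ccw_coord_iff hs ht
  have hmono : ∀ s ∈ Ioo (-Real.pi) Real.pi, ∀ t ∈ Ioo (-Real.pi) Real.pi, s < t → G s < G t := by
    intro s hs t ht hst
    rw [← hccw _ (hG s hs) _ (hG t ht), hGe s hs, hGe t ht, ← hfix]
    exact (hf _ _ _).2 ((hccw s hs t ht).2 hst)
  set F₀ : ℝ → ℝ := fun t => if t ∈ Ioo (-Real.pi) Real.pi then G t else t with hF₀
  have hF₁ : ∀ t ∈ Ioo (-Real.pi) Real.pi, F₀ t = G t := fun t ht => if_pos ht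
  have hF₂ : ∀ t, t ∉ Ioo (-Real.pi) Real.pi → F₀ t = t := fun t ht => if_neg ht
  have hstrict : StrictMono F₀ := by
    intro s t hst
    by_cases hs : s ∈ Ioo (-Real.pi) Real.pi <;> by_cases ht : t ∈ Ioo (-Real.pi) Real.pi
    · rw [hF₁ s hs, hF₁ t ht]; exact hmono s hs t ht hst
    · rw [hF₁ s hs, hF₂ t ht]
      have h1 : Real.pi ≤ t := by
        by_contra hcon
        exact ht ⟨hs.1.trans hst, not_le.1 hcon⟩
      exact (hG s hs).2.trans_le h1
    · rw [hF₂ s hs, hF₁ t ht]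
      have h1 : s ≤ -Real.pi := by
        by_contra hcon
        exact hs ⟨not_le.1 hcon, hst.trans ht.2⟩
      exact h1.trans_lt (hG t ht).1
    · rw [hF₂ s hs, hF₂ t ht]; exact hst
  have hsurj : Function.Surjective F₀ := by
    intro y
    by_cases hy : y ∈ Ioo (-Real.pi) Real.pi
    · have hne : f.symm (e y) ≠ e Real.pi := by
        intro h
        refine he.ne_base hy ?_
        rw [← hfix, ← h, f.apply_symm_apply]
      obtain ⟨t, ht, hte⟩ := he.exists_angle hne
      refine ⟨t, ?_⟩
      rw [hF₁ t ht]
      refine he.injOn (hG t ht) hy ?_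
      rw [hGe t ht, hte, f.apply_symm_apply]
    · exact ⟨y, hF₂ y hy⟩
  have hpi : F₀ Real.pi = Real.pi := hF₂ _ fun h => lt_irrefl _ h.2
  have hnpi : F₀ (-Real.pi) = -Real.pi := hF₂ _ fun h => lt_irrefl _ h.1
  refine ⟨StrictMono.orderIsoOfSurjective F₀ hstrict hsurj, ⟨hpi, hnpi, fun t ht => ?_⟩⟩
  change f (e t) = e (F₀ t)
  rcases ht.1.eq_or_lt with rfl | h1
  · rw [hnpi, he.neg_pi, hfix]
  rcases ht.2.eq_or_lt with rfl | h2
  · rw [hpi, hfix]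
  rw [hF₁ t ⟨h1, h2⟩, hGe t ⟨h1, h2⟩]

/-! ### Orbits on the line -/

theorem exists_tendsto_iterate_of_le {F : ℝ ≃o ℝ} {u x : ℝ} (hu : u ≤ F u) (hux : u ≤ x)
    (hx : F x = x) : ∃ w ∈ Icc u x, F w = w ∧ Tendsto (fun n => F^[n] u) atTop (𝓝 w) := by
  have hmono : Monotone fun n => F^[n] u := F.monotone.monotone_iterate_of_le_map hu
  have hle : ∀ n, F^[n] u ≤ x := fun n =>
    calc F^[n] u ≤ F^[n] x := F.monotone.iterate n hux
      _ = x := Function.iterate_fixed hx n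
  have hbdd : BddAbove (range fun n => F^[n] u) := ⟨x, by rintro _ ⟨n, rfl⟩; exact hle n⟩
  have hlim := tendsto_atTop_ciSup hmono hbdd
  exact ⟨_, ⟨hmono.ge_of_tendsto hlim 0, ciSup_le hle⟩,
    isFixedPt_of_tendsto_iterate hlim F.continuous.continuousAt, hlim⟩

theorem exists_tendsto_iterate_of_ge {F : ℝ ≃o ℝ} {u y : ℝ} (hu : F u ≤ u) (hyu : y ≤ u)
    (hy : F y = y) : ∃ w ∈ Icc y u, F w = w ∧ Tendsto (fun n => F^[n] u) atTop (𝓝 w) := by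
  have hmono : Antitone fun n => F^[n] u := F.monotone.antitone_iterate_of_map_le hu
  have hle : ∀ n, y ≤ F^[n] u := fun n =>
    calc y = F^[n] y := (Function.iterate_fixed hy n).symm
      _ ≤ F^[n] u := F.monotone.iterate n hyu
  have hbdd : BddBelow (range fun n => F^[n] u) := ⟨y, by rintro _ ⟨n, rfl⟩; exact hle n⟩
  have hlim := tendsto_atTop_ciInf hmono hbdd
  exact ⟨_, ⟨le_ciInf hle, hmono.le_of_tendsto hlim 0⟩,
    isFixedPt_of_tendsto_iterate hlim F.continuous.continuousAt, hlim⟩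

/-- Every orbit between two fixed points converges to a fixed point between them. -/
theorem exists_tendsto_iterate {F : ℝ ≃o ℝ} {y u x : ℝ} (hy : F y = y) (hx : F x = x)
    (hyu : y ≤ u) (hux : u ≤ x) :
    ∃ w ∈ Icc y x, F w = w ∧ Tendsto (fun n => F^[n] u) atTop (𝓝 w) := by
  rcases le_total u (F u) with h | h
  · obtain ⟨w, hw, h'⟩ := exists_tendsto_iterate_of_le h hux hx
    exact ⟨w, ⟨hyu.trans hw.1, hw.2⟩, h'⟩
  · obtain ⟨w, hw, h'⟩ := exists_tendsto_iterate_of_ge h hyu hy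
    exact ⟨w, ⟨hw.1, hw.2.trans hux⟩, h'⟩

theorem tendsto_iterate_of_lt {F : ℝ ≃o ℝ} {u x : ℝ} (hu : u < F u) (hux : u < x) (hx : F x = x)
    (hno : ∀ t ∈ Ioo u x, F t ≠ t) : Tendsto (fun n => F^[n] u) atTop (𝓝 x) := by
  obtain ⟨w, hw, hFw, hlim⟩ := exists_tendsto_iterate_of_le hu.le hux.le hx
  rcases hw.1.eq_or_lt with rfl | h1
  · exact (hu.ne' hFw).elim
  rcases hw.2.eq_or_lt with rfl | h2
  · exact hlim
  · exact (hno w ⟨h1, h2⟩ hFw).elim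

theorem tendsto_iterate_of_gt {F : ℝ ≃o ℝ} {u y : ℝ} (hu : F u < u) (hyu : y < u) (hy : F y = y)
    (hno : ∀ t ∈ Ioo y u, F t ≠ t) : Tendsto (fun n => F^[n] u) atTop (𝓝 y) := by
  obtain ⟨w, hw, hFw, hlim⟩ := exists_tendsto_iterate_of_ge hu.le hyu.le hy
  rcases hw.2.eq_or_lt with rfl | h1
  · exact (hu.ne hFw).elim
  rcases hw.1.eq_or_lt with rfl | h2
  · exact hlim
  · exact (hno w ⟨h2, h1⟩ hFw).elim

/-! ### Fixed points of maps that preserve very full laminations -/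

namespace Lamination

/-- The homeomorphism `f` maps `L` onto itself. -/
def PreservedBy (L : Lamination) (f : Circle ≃ₜ Circle) : Prop :=
  ∀ a b, L.IsLeaf (f a) (f b) ↔ L.IsLeaf a b

theorem PreservedBy.inv {L : Lamination} {f : Circle ≃ₜ Circle} (h : L.PreservedBy f) :
    L.PreservedBy f⁻¹ := by
  intro a b
  rw [← h]
  exact iff_of_eq (congrArg₂ _ (f.apply_symm_apply a) (f.apply_symm_apply b))

end Lamination

section

variable {e : ℝ → Circle} {f : Circle ≃ₜ Circle} {F : ℝ ≃o ℝ} {L : Lamination}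

/-- A fixed point `x` that is isolated on both sides and is not an endpoint of the invariant
lamination is attracting or repelling on both sides: if the map pushed both ends of a short leaf
around `x` in the same direction, the images of the leaf would converge to a leaf ending at `x`. -/
theorem exists_leaf_around (he : IsCoord e) (hF : IsLift e f F) (hL : L.IsVeryFull)
    (hinv : L.PreservedBy f) {y x z : ℝ} (hyx : y < x) (hxz : x < z) (hy : -Real.pi ≤ y)
    (hz : z ≤ Real.pi) (hFy : F y = y) (hFx : F x = x) (hFz : F z = z)
    (hyx' : ∀ t ∈ Ioo y x, F t ≠ t) (hxz' : ∀ t ∈ Ioo x z, F t ≠ t) (hx : e x ∉ L.endpoints) :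
    ∃ u ∈ Ioo y x, ∃ v ∈ Ioo x z, L.IsLeaf (e u) (e v) ∧
      ((u < F u ∧ F v < v) ∨ (F u < u ∧ v < F v)) := by
  obtain ⟨u, hu, v, hv, huv⟩ := he.exists_rainbow hL hx hyx hxz
  refine ⟨u, hu, v, hv, huv, ?_⟩
  have hleaf := hF.isLeaf_iterate hinv (u := u) (v := v) ⟨by linarith [hu.1], by linarith [hu.2]⟩
    ⟨by linarith [hv.1], by linarith [hv.2]⟩ huv
  have hyu : ∀ t ∈ Ioo y u, F t ≠ t := fun t ht => hyx' t ⟨ht.1, ht.2.trans hu.2⟩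
  have hux : ∀ t ∈ Ioo u x, F t ≠ t := fun t ht => hyx' t ⟨hu.1.trans ht.1, ht.2⟩
  have hxv : ∀ t ∈ Ioo x v, F t ≠ t := fun t ht => hxz' t ⟨ht.1, ht.2.trans hv.2⟩
  have hvz : ∀ t ∈ Ioo v z, F t ≠ t := fun t ht => hxz' t ⟨hv.1.trans ht.1, ht.2⟩
  rcases lt_or_gt_of_ne (hyx' u hu) with h1 | h1 <;> rcases lt_or_gt_of_ne (hxz' v hv) with h2 | h2
  · have l1 := (he.continuous.tendsto _).comp (tendsto_iterate_of_gt h1 hu.1 hFy hyu)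
    have l2 := (he.continuous.tendsto _).comp (tendsto_iterate_of_gt h2 hv.1 hFx hxv)
    exact (hx (Lamination.isLeaf_of_tendsto l1 l2 (he.ne_of_lt hyx (by linarith))
      (Eventually.of_forall hleaf)).symm.mem_endpoints).elim
  · exact Or.inr ⟨h1, h2⟩
  · exact Or.inl ⟨h1, h2⟩
  · have l1 := (he.continuous.tendsto _).comp (tendsto_iterate_of_lt h1 hu.2 hFx hux)
    have l2 := (he.continuous.tendsto _).comp (tendsto_iterate_of_lt h2 hv.2 hFz hvz)
    exact (hx (Lamination.isLeaf_of_tendsto l1 l2 (he.ne_of_lt hxz (by linarith))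
      (Eventually.of_forall hleaf)).mem_endpoints).elim

/-- The two neighbours of an isolated fixed point that is not an endpoint span a leaf. -/
theorem isLeaf_neighbours (he : IsCoord e) (hF : IsLift e f F) (hL : L.IsVeryFull)
    (hinv : L.PreservedBy f) {y x z : ℝ} (hyx : y < x) (hxz : x < z) (hy : -Real.pi ≤ y)
    (hz : z ≤ Real.pi) (hyz : z < y + 2 * Real.pi) (hFy : F y = y) (hFx : F x = x) (hFz : F z = z)
    (hyx' : ∀ t ∈ Ioo y x, F t ≠ t) (hxz' : ∀ t ∈ Ioo x z, F t ≠ t) (hx : e x ∉ L.endpoints) :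
    L.IsLeaf (e y) (e z) := by
  obtain ⟨u, hu, v, hv, huv, h⟩ :=
    exists_leaf_around he hF hL hinv hyx hxz hy hz hFy hFx hFz hyx' hxz' hx
  have key : ∀ (f : Circle ≃ₜ Circle) (F : ℝ ≃o ℝ), IsLift e f F → L.PreservedBy f → F y = y →
      F z = z → (∀ t ∈ Ioo y x, F t ≠ t) → (∀ t ∈ Ioo x z, F t ≠ t) → F u < u → v < F v →
      L.IsLeaf (e y) (e z) := by
    intro f F hF hinv hFy hFz hyx' hxz' h1 h2
    have hleaf := hF.isLeaf_iterate hinv (u := u) (v := v)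
      ⟨by linarith [hu.1], by linarith [hu.2]⟩ ⟨by linarith [hv.1], by linarith [hv.2]⟩ huv
    have l1 := (he.continuous.tendsto _).comp
      (tendsto_iterate_of_gt h1 hu.1 hFy fun t ht => hyx' t ⟨ht.1, ht.2.trans hu.2⟩)
    have l2 := (he.continuous.tendsto _).comp
      (tendsto_iterate_of_lt h2 hv.2 hFz fun t ht => hxz' t ⟨hv.1.trans ht.1, ht.2⟩)
    exact Lamination.isLeaf_of_tendsto l1 l2 (he.ne_of_lt (hyx.trans hxz) hyz)
      (Eventually.of_forall hleaf)
  rcases h with ⟨h1, h2⟩ | ⟨h1, h2⟩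
  · have hsymm : ∀ t, F.symm t = t ↔ F t = t := fun t => by rw [OrderIso.symm_apply_eq, eq_comm]
    refine key f⁻¹ F.symm hF.symm hinv.inv ((hsymm y).2 hFy) ((hsymm z).2 hFz)
      (fun t ht h => hyx' t ht ((hsymm t).1 h)) (fun t ht h => hxz' t ht ((hsymm t).1 h)) ?_ ?_
    · rwa [OrderIso.symm_apply_lt]
    · rwa [OrderIso.lt_symm_apply]
  · exact key f F hF hinv hFy hFz hyx' hxz' h1 h2

theorem exists_next_fixed {t s ε : ℝ} (hts : t < s) (hs : F s = s) (hε : 0 < ε)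
    (hiso : ∀ r, |r - t| < ε → F r = r → r = t) :
    ∃ z ∈ Ioc t s, F z = z ∧ ∀ r ∈ Ioo t z, F r ≠ r := by
  have hcpt : IsCompact (Icc (t + min ε (s - t)) s ∩ {r | F r = r}) :=
    isCompact_Icc.inter_right (isClosed_eq F.continuous continuous_id)
  have hmin := min_le_right ε (s - t)
  have hmin' := min_le_left ε (s - t)
  have hpos : 0 < min ε (s - t) := lt_min hε (by linarith)
  obtain ⟨z, ⟨hz, hFz⟩, hleast⟩ := hcpt.exists_isLeast ⟨s, ⟨by linarith, le_rfl⟩, hs⟩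
  refine ⟨z, ⟨by linarith [hz.1], hz.2⟩, hFz, fun r hr hFr => ?_⟩
  by_cases h : r < t + min ε (s - t)
  · have := hiso r (by rw [abs_lt]; constructor <;> linarith [hr.1]) hFr
    linarith [hr.1]
  · exact absurd (hleast ⟨⟨not_lt.1 h, hr.2.le.trans hz.2⟩, hFr⟩) (not_le.2 hr.2)

theorem exists_prev_fixed {t s ε : ℝ} (hst : s < t) (hs : F s = s) (hε : 0 < ε)
    (hiso : ∀ r, |r - t| < ε → F r = r → r = t) :
    ∃ y ∈ Ico s t, F y = y ∧ ∀ r ∈ Ioo y t, F r ≠ r := by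
  have hcpt : IsCompact (Icc s (t - min ε (t - s)) ∩ {r | F r = r}) :=
    isCompact_Icc.inter_right (isClosed_eq F.continuous continuous_id)
  have hmin := min_le_right ε (t - s)
  have hmin' := min_le_left ε (t - s)
  have hpos : 0 < min ε (t - s) := lt_min hε (by linarith)
  obtain ⟨z, ⟨hz, hFz⟩, hgreatest⟩ := hcpt.exists_isGreatest ⟨s, ⟨le_rfl, by linarith⟩, hs⟩
  refine ⟨z, ⟨hz.1, by linarith [hz.2]⟩, hFz, fun r hr hFr => ?_⟩
  by_cases h : t - min ε (t - s) < r
  · have := hiso r (by rw [abs_lt]; constructor <;> linarith [hr.2]) hFr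
    linarith [hr.2]
  · exact absurd (hgreatest ⟨⟨hz.1.trans hr.1.le, not_lt.1 h⟩, hFr⟩) (not_le.2 hr.1)

/-- Isolated fixed points cannot accumulate from below at a base point outside `L₁.endpoints`.
Otherwise a leaf of `L₁` around the base point is moved to a leaf with fixed ends `x` and `w`,
where `x` is one of the accumulating fixed points. If `y' < y < x < z < z'` are consecutive fixed
points, then `y z` is a leaf of `L₂`, hence `y' x` and `x z'` are leaves of `L₁`, which makes three
leaves at `x`. -/
theorem not_accumulating_at_pi {L₁ L₂ : Lamination} (he : IsCoord e) (hF : IsLift e f F)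
    (h₁ : L₁.IsVeryFull) (h₁' : L₁.IsLoose) (hinv₁ : L₁.PreservedBy f) (h₂ : L₂.IsVeryFull)
    (hinv₂ : L₂.PreservedBy f) (hdisj : Disjoint L₁.endpoints L₂.endpoints)
    (hbase : e Real.pi ∉ L₁.endpoints) (hD : ¬ AccPt (e Real.pi) (𝓟 (derivedSet (Fix f))))
    (hacc : ∀ m < Real.pi, ∃ t ∈ Ioo m Real.pi, F t = t) : False := by
  have hpi := Real.pi_pos
  obtain ⟨m₀, hm₀, hm₀', hiso⟩ : ∃ m₀, -Real.pi < m₀ ∧ m₀ < Real.pi ∧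
      ∀ t ∈ Ioo m₀ Real.pi, F t = t → ∃ ε > 0, ∀ r, |r - t| < ε → F r = r → r = t := by
    rw [accPt_iff_nhds] at hD
    push Not at hD
    obtain ⟨U, hU, hUD⟩ := hD
    have h1 : ∀ᶠ t in 𝓝 Real.pi, e t ∈ U := he.continuous.continuousAt hU
    obtain ⟨δ, hδ, hball⟩ := Metric.eventually_nhds_iff.1 h1
    refine ⟨max 0 (Real.pi - δ), (by linarith : -Real.pi < 0).trans_le (le_max_left _ _),
      max_lt hpi (by linarith), fun t ht hFt => ?_⟩
    have ht0 := (le_max_left _ _).trans_lt ht.1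
    have ht1 := (le_max_right _ _).trans_lt ht.1
    have htI : t ∈ Ioo (-Real.pi) Real.pi := ⟨by linarith, ht.2⟩
    have htU : e t ∈ U := hball (by rw [Real.dist_eq, abs_lt]; constructor <;> linarith [ht.2])
    have hnot : ¬ AccPt (e t) (𝓟 (Fix f)) := fun h => he.ne_base htI (hUD _ ⟨htU, h⟩)
    rw [accPt_iff_nhds] at hnot
    push Not at hnot
    obtain ⟨V, hV, hVF⟩ := hnot
    have h2 : ∀ᶠ r in 𝓝 t, e r ∈ V := he.continuous.continuousAt hV
    replace h2 := h2.and (Ioo_mem_nhds htI.1 htI.2)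
    obtain ⟨ε, hε, hball'⟩ := Metric.eventually_nhds_iff.1 h2
    refine ⟨ε, hε, fun r hr hFr => ?_⟩
    obtain ⟨hrV, hrI⟩ := hball' (by rwa [Real.dist_eq])
    exact he.injOn hrI htI (hVF _ ⟨hrV, (hF.fixed_iff he hrI).2 hFr⟩)
  obtain ⟨q₀, hq₀, hFq₀⟩ := hacc m₀ hm₀'
  obtain ⟨q₁, hq₁, hFq₁⟩ := hacc q₀ hq₀.2
  obtain ⟨q₂, hq₂, hFq₂⟩ := hacc q₁ hq₁.2
  obtain ⟨q₃, hq₃, hFq₃⟩ := hacc q₂ hq₂.2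
  -- a leaf around the base point converges to a leaf with fixed ends
  obtain ⟨u, hu, v, hv, huv⟩ := he.exists_rainbow h₁ hbase (y := q₃) (z := q₀ + 2 * Real.pi) hq₃.2
    (by linarith [hq₀.1])
  have hev : e v = e (v - 2 * Real.pi) := by rw [← he.add_two_pi (v - 2 * Real.pi)]; congr 1; ring
  rw [hev] at huv
  obtain ⟨s, hs, hFs⟩ := hacc u hu.2
  obtain ⟨x, hx, hFx, hlimu⟩ := exists_tendsto_iterate hFq₃ hFs hu.1.le hs.1.le
  obtain ⟨w, hw, hFw, hlimv⟩ := exists_tendsto_iterate (u := v - 2 * Real.pi) hF.map_neg_pi hFq₀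
    (by linarith [hv.1]) (by linarith [hv.2])
  have h01 := hq₁.1
  have h12 := hq₂.1
  have h23 := hq₃.1
  have h0 := hq₀.1
  have h3x := hx.1
  have hw0 := hw.2
  have hxpi : x < Real.pi := hx.2.trans_lt hs.2
  have hleafxw : L₁.IsLeaf (e x) (e w) := by
    refine Lamination.isLeaf_of_tendsto ((he.continuous.tendsto _).comp hlimu)
      ((he.continuous.tendsto _).comp hlimv) ?_ (Eventually.of_forall
        (hF.isLeaf_iterate hinv₁ ⟨?_, hu.2.le⟩ ⟨?_, ?_⟩ huv))
    · exact (he.ne_of_lt (by linarith) (by linarith [hw.1])).symm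
    · linarith [hu.1]
    · linarith [hv.1]
    · linarith [hv.2, hq₀.2]
  have hwpi : -Real.pi < w := by
    refine lt_of_le_of_ne hw.1 ?_
    rintro rfl
    rw [he.neg_pi] at hleafxw
    exact hbase hleafxw.symm.mem_endpoints
  -- the neighbouring fixed points
  obtain ⟨ε, hε, hisox⟩ := hiso x ⟨by linarith, hxpi⟩ hFx
  obtain ⟨y, hy, hFy, hyx⟩ := exists_prev_fixed (t := x) (s := q₂) (by linarith) hFq₂ hε hisox
  obtain ⟨s₁, hs₁, hFs₁⟩ := hacc x hxpi
  obtain ⟨z, hz, hFz, hxz⟩ := exists_next_fixed hs₁.1 hFs₁ hε hisox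
  have hy2 := hy.1
  have hyx0 := hy.2
  have hxz0 := hz.1
  have hzpi : z < Real.pi := hz.2.trans_lt hs₁.2
  obtain ⟨εy, hεy, hisoy⟩ := hiso y ⟨by linarith, by linarith⟩ hFy
  obtain ⟨y', hy', hFy', hyy'⟩ := exists_prev_fixed (t := y) (s := q₁) (by linarith) hFq₁ hεy hisoy
  obtain ⟨εz, hεz, hisoz⟩ := hiso z ⟨by linarith, hzpi⟩ hFz
  obtain ⟨s₂, hs₂, hFs₂⟩ := hacc z hzpi
  obtain ⟨z', hz', hFz', hzz'⟩ := exists_next_fixed hs₂.1 hFs₂ hεz hisoz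
  have hy'1 := hy'.1
  have hy'y := hy'.2
  have hzz'0 := hz'.1
  have hz'pi : z' < Real.pi := hz'.2.trans_lt hs₂.2
  have hx2 : e x ∉ L₂.endpoints := disjoint_left.1 hdisj hleafxw.mem_endpoints
  have hyzleaf := isLeaf_neighbours he hF h₂ hinv₂ hyx0 hxz0 (by linarith) hzpi.le (by linarith)
    hFy hFx hFz hyx hxz hx2
  have hy1 : e y ∉ L₁.endpoints := disjoint_right.1 hdisj hyzleaf.mem_endpoints
  have hz1 : e z ∉ L₁.endpoints := disjoint_right.1 hdisj hyzleaf.symm.mem_endpoints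
  have hleafy := isLeaf_neighbours he hF h₁ hinv₁ hy'y hyx0 (by linarith) hxpi.le (by linarith)
    hFy' hFy hFx hyy' hyx hy1
  have hleafz := isLeaf_neighbours he hF h₁ hinv₁ hxz0 hzz'0 (by linarith) hz'pi.le (by linarith)
    hFx hFz hFz' hxz hzz' hz1
  exact h₁'.eq_of_three_leaves hleafxw hleafy.symm hleafz
    (he.ne_of_lt (by linarith) (by linarith)) (he.ne_of_lt (by linarith) (by linarith))
    (he.ne_of_lt (by linarith) (by linarith))

theorem isClosed_Fix (f : Circle ≃ₜ Circle) : IsClosed (Fix f) :=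
  isClosed_eq f.continuous continuous_id

/-- A map with countably many fixed points that preserves two very full loose laminations without
common endpoints has only finitely many: otherwise its countable closed set of accumulation points
of fixed points has an isolated point. -/
theorem finite_Fix {L₁ L₂ : Lamination} (hf : f ∈ HomeoPlus) (h₁ : L₁.IsVeryFull)
    (h₁' : L₁.IsLoose) (hinv₁ : L₁.PreservedBy f) (h₂ : L₂.IsVeryFull) (h₂' : L₂.IsLoose)
    (hinv₂ : L₂.PreservedBy f) (hdisj : Disjoint L₁.endpoints L₂.endpoints)
    (hcount : (Fix f).Countable) : (Fix f).Finite := by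
  by_contra hinf
  have hsub : derivedSet (Fix f) ⊆ Fix f := (isClosed_iff_derivedSet_subset _).1 (isClosed_Fix f)
  obtain ⟨p₀, -, hp₀⟩ := Set.Infinite.exists_accPt_of_subset_isCompact hinf
    (isCompact_univ (X := Circle)) (subset_univ _)
  -- a countable closed set has an isolated point
  have hpre : ¬ Preperfect (derivedSet (Fix f)) := by
    intro hpre
    obtain ⟨φ, hφ, -, hinj⟩ := Perfect.exists_nat_bool_injection
      ⟨isClosed_derivedSet _, hpre⟩ ⟨p₀, hp₀⟩
    have hlt : Cardinal.aleph0 < Cardinal.mk (ℕ → Bool) := by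
      simp [Cardinal.aleph0_lt_continuum]
    have hc : (range φ).Countable := hcount.mono (hφ.trans hsub)
    rw [← image_univ] at hc
    have := countable_univ_iff.1 (countable_of_injective_of_countable_image hinj.injOn hc)
    exact not_le.2 hlt (Cardinal.mk_le_aleph0_iff.2 this)
  unfold Preperfect at hpre
  push Not at hpre
  obtain ⟨p, hp, hpD⟩ := hpre
  obtain ⟨e, he, rfl, c, hc⟩ := exists_coord p
  have hfix : f (e Real.pi) = e Real.pi := hsub hp
  obtain ⟨F, hF⟩ := exists_isLift hf hc hfix
  obtain ⟨F', hF', hFF'⟩ := hF.neg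
  have he' := he.neg
  have hbase' : e (-Real.pi) = e Real.pi := he.neg_pi
  -- fixed points accumulate at the base point from one of the two sides
  have hside : (∀ m < Real.pi, ∃ t ∈ Ioo m Real.pi, F t = t) ∨
      (∀ m < Real.pi, ∃ t ∈ Ioo m Real.pi, F' t = t) := by
    by_contra hcon
    push Not at hcon
    obtain ⟨⟨m₁, hm₁, hno₁⟩, m₂, hm₂, hno₂⟩ := hcon
    have hK : IsClosed (e '' Icc (-m₂) m₁) := (isCompact_Icc.image he.continuous).isClosed
    have hpK : e Real.pi ∉ e '' Icc (-m₂) m₁ := by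
      rintro ⟨t, ht, h⟩
      exact he.ne_base ⟨by linarith [ht.1], by linarith [ht.2]⟩ h
    obtain ⟨y, ⟨hyK, hy⟩, hyp⟩ := accPt_iff_nhds.1 hp _ (hK.isOpen_compl.mem_nhds hpK)
    obtain ⟨t, ht, rfl⟩ := he.exists_angle hyp
    have hFt : F t = t := (hF.fixed_iff he ht).1 hy
    have h1 : t ≤ m₁ := by
      by_contra h
      exact hno₁ t ⟨not_le.1 h, ht.2⟩ hFt
    have h2 : -m₂ ≤ t := by
      by_contra h
      exact hno₂ (-t) ⟨by linarith, by linarith [ht.1]⟩ (by rw [hFF', neg_neg, hFt])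
    exact hyK ⟨t, ⟨h2, h1⟩, rfl⟩
  have key : ∀ M₁ M₂ : Lamination, M₁.IsVeryFull → M₁.IsLoose → M₁.PreservedBy f → M₂.IsVeryFull →
      M₂.PreservedBy f → Disjoint M₁.endpoints M₂.endpoints → e Real.pi ∉ M₁.endpoints → False := by
    intro M₁ M₂ k₁ k₁' ki₁ k₂ ki₂ kd kb
    rcases hside with h | h
    · exact not_accumulating_at_pi he hF k₁ k₁' ki₁ k₂ ki₂ kd kb hpD h
    · exact not_accumulating_at_pi he' hF' k₁ k₁' ki₁ k₂ ki₂ kd (by rwa [hbase'])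
        (by rwa [hbase']) h
  by_cases hE : e Real.pi ∈ L₁.endpoints
  · exact key L₂ L₁ h₂ h₂' hinv₂ h₁ hinv₁ hdisj.symm (disjoint_left.1 hdisj hE)
  · exact key L₁ L₂ h₁ h₁' hinv₁ h₂ hinv₂ hdisj hE

end

/-! ### Arcs, attracting and repelling fixed points -/

theorem Ccw.not_swap {a b c : Circle} (h : Ccw a b c) : ¬ Ccw a c b := by
  rw [ccw_iff] at *
  rw [area_swap_right]
  linarith

theorem Ccw.rotate {a b c : Circle} (h : Ccw a b c) : Ccw b c a := by
  rw [ccw_iff] at *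
  rwa [area_rotate]

theorem Ccw.ne_right {a b c : Circle} (h : Ccw a b c) : c ≠ a := by
  rintro rfl
  rw [ccw_iff, area_eq] at h
  ring_nf at h
  exact lt_irrefl _ h

theorem exists_mul_exp_Ico (c x : Circle) (u : ℝ) :
    ∃ t ∈ Ico u (u + 2 * Real.pi), c * Circle.exp t = x := by
  obtain ⟨t, ht, h⟩ := exists_mul_exp (c * Circle.exp (u + Real.pi)) x
  rcases ht.2.eq_or_lt with rfl | h'
  · refine ⟨u, ⟨le_rfl, by linarith [Real.pi_pos]⟩, ?_⟩
    rw [← h, mul_assoc, ← Circle.exp_add, add_assoc, ← two_mul, Circle.exp_add, Circle.exp_two_pi,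
      mul_one]
  · refine ⟨u + Real.pi + t, ⟨by linarith [ht.1], by linarith⟩, ?_⟩
    rw [← h, mul_assoc, ← Circle.exp_add]

section Arcs

variable {e : ℝ → Circle} {c : Circle}

theorem ccw_coord (hc : ∀ t, e t = c * Circle.exp t) {s t u : ℝ} (hst : s < t) (htu : t < u)
    (hus : u < s + 2 * Real.pi) : Ccw (e s) (e t) (e u) := by
  rw [hc, hc, hc]
  exact ccw_mul_exp hst htu hus

theorem closedArc_coord (hc : ∀ t, e t = c * Circle.exp t) {u v : ℝ} (huv : u < v)
    (hvu : v < u + 2 * Real.pi) : closedArc (e u) (e v) = e '' Icc u v := by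
  have he : IsCoord e := ⟨c, Or.inl hc⟩
  ext x
  constructor
  · intro hx
    obtain ⟨t, ht, rfl⟩ : ∃ t ∈ Ico u (u + 2 * Real.pi), e t = x := by
      simp only [hc]; exact exists_mul_exp_Ico c x u
    refine ⟨t, ⟨ht.1, ?_⟩, rfl⟩
    by_contra hvt
    push Not at hvt
    have h1 := ccw_coord hc huv hvt ht.2
    rcases hx with h | h | h
    · exact he.ne_of_lt (huv.trans hvt) ht.2 h.symm
    · exact he.ne_of_lt hvt (by linarith [ht.2]) h.symm
    · exact h1.not_swap h
  · rintro ⟨t, ht, rfl⟩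
    rcases ht.1.eq_or_lt with rfl | h1
    · exact Or.inl rfl
    rcases ht.2.eq_or_lt with rfl | h2
    · exact Or.inr (Or.inl rfl)
    · exact Or.inr (Or.inr (ccw_coord hc h1 h2 hvu))

/-- The complementary closed arc. -/
theorem closedArc_coord' (hc : ∀ t, e t = c * Circle.exp t) {u v : ℝ} (huv : u < v)
    (hvu : v < u + 2 * Real.pi) : closedArc (e v) (e u) = (e '' Ioo u v)ᶜ := by
  have he : IsCoord e := ⟨c, Or.inl hc⟩
  have h1 : e u = e (u + 2 * Real.pi) := (he.add_two_pi u).symm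
  rw [h1, closedArc_coord hc hvu (by linarith)]
  ext x
  obtain ⟨t, ht, rfl⟩ : ∃ t ∈ Ico u (u + 2 * Real.pi), e t = x := by
    simp only [hc]; exact exists_mul_exp_Ico c x u
  constructor
  · rintro ⟨s, hs, hst⟩ ⟨r, hr, hrt⟩
    exact he.ne_of_lt (s := r) (t := s) (by linarith [hr.2, hs.1]) (by linarith [hr.1, hs.2])
      (hrt.trans hst.symm)
  · intro h
    rcases ht.1.eq_or_lt with rfl | h2
    · exact ⟨_, ⟨hvu.le, le_rfl⟩, h1.symm⟩
    · refine ⟨t, ⟨?_, ht.2.le⟩, rfl⟩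
      by_contra hcon
      exact h ⟨t, ⟨h2, not_le.1 hcon⟩, rfl⟩

/-- An arc around `e x` that avoids the base point is an interval in the coordinates. -/
theorem exists_Icc_of_closedArc (hc : ∀ t, e t = c * Circle.exp t) {x : ℝ}
    (hx : x ∈ Ioo (-Real.pi) Real.pi) {p q : Circle} (hpq : Ccw p (e x) q)
    (hbase : e Real.pi ∉ closedArc p q) :
    ∃ s t, -Real.pi < s ∧ s < x ∧ x < t ∧ t < Real.pi ∧ closedArc p q = e '' Icc s t := by
  have he : IsCoord e := ⟨c, Or.inl hc⟩
  obtain ⟨s, hs, rfl⟩ := he.exists_angle (x := p) fun h => hbase (Or.inl h.symm)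
  obtain ⟨t, ht, rfl⟩ := he.exists_angle (x := q) fun h => hbase (Or.inr (Or.inl h.symm))
  have hst : s < t := by
    by_contra hcon
    rcases (not_lt.1 hcon).eq_or_lt with rfl | h
    · exact hpq.ne_right rfl
    · rw [closedArc_coord' hc h (by linarith [hs.2, ht.1])] at hbase
      refine hbase ?_
      rintro ⟨r, hr, h'⟩
      exact he.ne_base ⟨by linarith [hr.1, ht.1], by linarith [hr.2, hs.2]⟩ h'
  have harc := closedArc_coord hc hst (by linarith [hs.1, ht.2])
  have hmem : e x ∈ closedArc (e s) (e t) := Or.inr (Or.inr hpq)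
  rw [harc] at hmem
  obtain ⟨r, hr, hrx⟩ := hmem
  have hrx' : r = x := he.injOn ⟨by linarith [hr.1, hs.1], by linarith [hr.2, ht.2]⟩ hx hrx
  subst hrx'
  have hne1 : s ≠ r := by
    rintro rfl
    exact hpq.rotate.ne_right rfl
  have hne2 : r ≠ t := by
    rintro rfl
    exact hpq.rotate.rotate.ne_right rfl
  exact ⟨s, t, hs.1, lt_of_le_of_ne hr.1 hne1, lt_of_le_of_ne hr.2 hne2, ht.2, harc⟩

end Arcs

theorem IsLift.image_Icc {e : ℝ → Circle} {f : Circle ≃ₜ Circle} {F : ℝ ≃o ℝ} (hF : IsLift e f F)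
    {s t : ℝ} (hs : -Real.pi ≤ s) (ht : t ≤ Real.pi) :
    f '' (e '' Icc s t) = e '' Icc (F s) (F t) := by
  rw [← F.image_Icc, image_image, image_image]
  exact image_congr fun x hx => hF.apply_eq x ⟨hs.trans hx.1, hx.2.trans ht⟩

theorem IsLift.image_Ioo {e : ℝ → Circle} {f : Circle ≃ₜ Circle} {F : ℝ ≃o ℝ} (hF : IsLift e f F)
    {s t : ℝ} (hs : -Real.pi ≤ s) (ht : t ≤ Real.pi) :
    f '' (e '' Ioo s t) = e '' Ioo (F s) (F t) := by
  rw [← F.image_Ioo, image_image, image_image]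
  exact image_congr fun x hx => hF.apply_eq x ⟨hs.trans hx.1.le, hx.2.le.trans ht⟩

theorem inv_apply_eq_iff {f : Circle ≃ₜ Circle} {x : Circle} : f⁻¹ x = x ↔ f x = x := by
  constructor <;> intro h
  · conv_lhs => rw [← h]
    exact f.apply_symm_apply x
  · conv_lhs => rw [← h]
    exact f.symm_apply_apply x

theorem Fix_inv (f : Circle ≃ₜ Circle) : Fix f⁻¹ = Fix f := by
  ext x
  exact inv_apply_eq_iff

theorem IsAttracting.inv {f : Circle ≃ₜ Circle} {p : Circle} (h : IsAttracting f p) :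
    IsRepelling f⁻¹ p := by
  obtain ⟨hp, u, v, huv, hno, hsub⟩ := h
  refine ⟨inv_apply_eq_iff.2 hp, u, v, huv, fun x hx hfx => hno x hx (inv_apply_eq_iff.1 hfx), ?_⟩
  have h1 := f.symm.injective.image_strictMono hsub
  rwa [← image_comp, show (f.symm : Circle → Circle) ∘ f = id from funext f.symm_apply_apply,
    image_id] at h1

theorem IsRepelling.inv {f : Circle ≃ₜ Circle} {p : Circle} (h : IsRepelling f p) :
    IsAttracting f⁻¹ p := by
  obtain ⟨hp, u, v, huv, hno, hsub⟩ := h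
  refine ⟨inv_apply_eq_iff.2 hp, u, v, huv, fun x hx hfx => hno x hx (inv_apply_eq_iff.1 hfx), ?_⟩
  have h1 := f.symm.injective.image_strictMono hsub
  rwa [← image_comp, show (f.symm : Circle → Circle) ∘ f = id from funext f.symm_apply_apply,
    image_id] at h1

theorem image_closedArc {g : Circle ≃ₜ Circle} (hg : g ∈ HomeoPlus) (u v : Circle) :
    g '' closedArc u v = closedArc (g u) (g v) := by
  ext x
  obtain ⟨y, rfl⟩ := g.surjective x
  rw [g.injective.mem_set_image]
  simp only [closedArc, mem_ofPred_eq, g.injective.eq_iff]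
  exact or_congr Iff.rfl (or_congr Iff.rfl (hg u y v).symm)

theorem conj_apply_apply (f g : Circle ≃ₜ Circle) (x : Circle) : (g * f * g⁻¹) (g x) = g (f x) :=
  congrArg (fun y => g (f y)) (g.symm_apply_apply x)

theorem image_conj_image (f g : Circle ≃ₜ Circle) (s : Set Circle) :
    (g * f * g⁻¹) '' (g '' s) = g '' (f '' s) := by
  rw [image_image, image_image]
  exact image_congr fun x _ => conj_apply_apply f g x

theorem IsAttracting.conj {f g : Circle ≃ₜ Circle} (hg : g ∈ HomeoPlus) {p : Circle}
    (h : IsAttracting f p) : IsAttracting (g * f * g⁻¹) (g p) := by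
  obtain ⟨hp, u, v, huv, hno, hsub⟩ := h
  refine ⟨by rw [conj_apply_apply, hp], g u, g v, (hg _ _ _).2 huv, ?_, ?_⟩
  · rw [← image_closedArc hg]
    rintro _ ⟨x, hx, rfl⟩ hfx
    rw [conj_apply_apply] at hfx
    rw [hno x hx (g.injective hfx)]
  · rw [← image_closedArc hg, image_conj_image]
    exact g.injective.image_strictMono hsub

theorem IsRepelling.conj {f g : Circle ≃ₜ Circle} (hg : g ∈ HomeoPlus) {p : Circle}
    (h : IsRepelling f p) : IsRepelling (g * f * g⁻¹) (g p) := by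
  have h1 := (h.inv.conj hg).inv
  simpa [mul_assoc] using h1

theorem Fix_conj (f g : Circle ≃ₜ Circle) : Fix (g * f * g⁻¹) = g '' Fix f := by
  ext x
  obtain ⟨y, rfl⟩ := g.surjective x
  rw [g.injective.mem_set_image]
  simp only [Fix, mem_ofPred_eq, conj_apply_apply, g.injective.eq_iff]

theorem IsHyperbolic.inv {f : Circle ≃ₜ Circle} (h : IsHyperbolic f) : IsHyperbolic f⁻¹ := by
  obtain ⟨a, r, har, hfix, ha, hr⟩ := h
  exact ⟨r, a, har.symm, by rw [Fix_inv, hfix, pair_comm], hr.inv, ha.inv⟩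

theorem IsHyperbolic.conj {f g : Circle ≃ₜ Circle} (hg : g ∈ HomeoPlus) (h : IsHyperbolic f) :
    IsHyperbolic (g * f * g⁻¹) := by
  obtain ⟨a, r, har, hfix, ha, hr⟩ := h
  exact ⟨g a, g r, g.injective.ne har, by rw [Fix_conj, hfix, image_pair], ha.conj hg, hr.conj hg⟩

/-- A fixed point is not both attracting and repelling: near such a point the displacement on one
side would change sign without vanishing. -/
theorem IsAttracting.not_isRepelling {f : Circle ≃ₜ Circle} (hf : f ∈ HomeoPlus) {p r : Circle}
    (hpr : p ≠ r) (hfix : Fix f = {p, r}) (ha : IsAttracting f p) : ¬ IsRepelling f p := by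
  intro hr
  obtain ⟨e, he, rfl, c, hc⟩ := exists_coord r
  have hfr : f (e Real.pi) = e Real.pi := by
    have : e Real.pi ∈ Fix f := by rw [hfix]; simp
    exact this
  obtain ⟨F, hF⟩ := exists_isLift hf hc hfr
  obtain ⟨x, hx, rfl⟩ := he.exists_angle hpr
  obtain ⟨-, u, v, huv, hno, hsub⟩ := ha
  obtain ⟨s, t, hs, hsx, hxt, ht, harc⟩ := exists_Icc_of_closedArc hc hx huv
    fun h => hpr (hno _ h hfr).symm
  obtain ⟨-, u', v', huv', hno', hsub'⟩ := hr
  obtain ⟨s', t', hs', hsx', hxt', ht', harc'⟩ := exists_Icc_of_closedArc hc hx huv'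
    fun h => hpr (hno' _ h hfr).symm
  rw [harc, hF.image_Icc hs.le ht.le] at hsub
  rw [harc', hF.image_Icc hs'.le ht'.le] at hsub'
  have hsI : s ∈ Ioo (-Real.pi) Real.pi := ⟨hs, by linarith⟩
  have hsI' : s' ∈ Ioo (-Real.pi) Real.pi := ⟨hs', by linarith⟩
  have htI' : t' ∈ Ioo (-Real.pi) Real.pi := ⟨by linarith, ht'⟩
  have h1 : s ≤ F s := by
    obtain ⟨y, hy, h⟩ := hsub.1 (mem_image_of_mem e (left_mem_Icc.2 (F.monotone (by linarith))))
    rw [← he.injOn ⟨by linarith [hy.1], by linarith [hy.2]⟩ (hF.mem_Ioo hsI) h]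
    exact hy.1
  have h2 : F s' ≤ s' := by
    obtain ⟨y, hy, h⟩ := hsub'.1 (mem_image_of_mem e (left_mem_Icc.2 (by linarith)))
    have hy' : y ∈ Ioo (-Real.pi) Real.pi :=
      ⟨(hF.mem_Ioo hsI').1.trans_le hy.1, hy.2.trans_lt (hF.mem_Ioo htI').2⟩
    have := he.injOn hy' hsI' h
    linarith [hy.1]
  have hcont : ContinuousOn (fun t => F t - t) (uIcc s' s) :=
    (F.continuous.sub continuous_id).continuousOn
  obtain ⟨y, hy, hFy⟩ := intermediate_value_uIcc hcont
    (mem_uIcc_of_le (by linarith : F s' - s' ≤ 0) (by linarith : 0 ≤ F s - s))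
  have hyI : y ∈ Ioo (-Real.pi) Real.pi := ordConnected_Ioo.uIcc_subset hsI' hsI hy
  have hyx : y < x := by
    rcases le_total s' s with h | h
    · rw [uIcc_of_le h] at hy; linarith [hy.2]
    · rw [uIcc_of_ge h] at hy; linarith [hy.2]
  have hfy : e y ∈ Fix f := (hF.fixed_iff he hyI).2 (by linarith [hFy])
  rw [hfix] at hfy
  rcases hfy with h | h
  · exact hyx.ne (he.injOn hyI hx h)
  · exact he.ne_base hyI h

/-- If the ends of some interval around `x` move towards `x`, then its arc witnesses that `e x` is
attracting and the complementary arc witnesses that the base point is repelling. -/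
theorem isAttracting_and_isRepelling_of_lift {f : Circle ≃ₜ Circle} {e : ℝ → Circle} {c : Circle}
    {F : ℝ ≃o ℝ} (hc : ∀ t, e t = c * Circle.exp t) (hF : IsLift e f F) {x : ℝ}
    (hx : x ∈ Ioo (-Real.pi) Real.pi) (hfix : Fix f = {e x, e Real.pi}) {u v : ℝ}
    (hu : u ∈ Ioo (-Real.pi) x) (hv : v ∈ Ioo x Real.pi) (hFu : u < F u) (hFv : F v < v) :
    IsAttracting f (e x) ∧ IsRepelling f (e Real.pi) := by
  have he : IsCoord e := ⟨c, Or.inl hc⟩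
  have hux := hu.2
  have hxv := hv.1
  have huI : u ∈ Ioo (-Real.pi) Real.pi := ⟨hu.1, by linarith [hv.2]⟩
  have hvI : v ∈ Ioo (-Real.pi) Real.pi := ⟨by linarith [hu.1], hv.2⟩
  have huv : u < v := by linarith
  have hvu : v < u + 2 * Real.pi := by linarith [hu.1, hv.2]
  have hfx : e x ∈ Fix f := by rw [hfix]; simp
  have hfr : e Real.pi ∈ Fix f := by rw [hfix]; simp
  have hFx := (hF.fixed_iff he hx).1 hfx
  have hFuv : F u ≤ F v := F.monotone huv.le
  constructor
  · refine ⟨hfx, e u, e v, ccw_coord hc hux hxv hvu, ?_, ?_⟩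
    · rw [closedArc_coord hc huv hvu]
      rintro _ ⟨t, ht, rfl⟩ hft
      have : e t ∈ Fix f := hft
      rw [hfix] at this
      rcases this with h | h
      · exact h
      · exact (he.ne_base ⟨by linarith [ht.1, hu.1], by linarith [ht.2, hv.2]⟩ h).elim
    · rw [closedArc_coord hc huv hvu, hF.image_Icc hu.1.le hv.2.le]
      refine ⟨image_mono (Icc_subset_Icc hFu.le hFv.le), fun hsub => ?_⟩
      obtain ⟨y, hy, h⟩ := hsub (mem_image_of_mem e (left_mem_Icc.2 huv.le))
      have := he.injOn ⟨by linarith [hy.1, hu.1], by linarith [hy.2, hv.2]⟩ huI h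
      linarith [hy.1]
  · refine ⟨hfr, e v, e u, ?_, ?_, ?_⟩
    · rw [← he.add_two_pi u]
      exact ccw_coord hc hv.2 (by linarith [hu.1]) (by linarith)
    · rw [closedArc_coord' hc huv hvu]
      intro y hy hfy
      have : y ∈ Fix f := hfy
      rw [hfix] at this
      rcases this with rfl | h
      · exact (hy ⟨x, ⟨hux, hxv⟩, rfl⟩).elim
      · exact h
    · rw [closedArc_coord' hc huv hvu, image_compl_eq f.bijective, hF.image_Ioo hu.1.le hv.2.le]
      refine ⟨compl_subset_compl.2 (image_mono (Ioo_subset_Ioo hFu.le hFv.le)), fun hsub => ?_⟩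
      have hFu' : F u ∈ Ioo u v := ⟨hFu, by linarith⟩
      obtain ⟨y, hy, h⟩ := compl_subset_compl.1 hsub (mem_image_of_mem e hFu')
      have := he.injOn ⟨by linarith [hy.1, hu.1], by linarith [hy.2, hv.2]⟩
        ⟨by linarith [hu.1], by linarith [hv.2]⟩ h
      linarith [hy.1]

/-- A homeomorphism with exactly two fixed points that preserves two very full laminations without
common endpoints is hyperbolic. -/
theorem isHyperbolic_of_Fix_eq_pair {f : Circle ≃ₜ Circle} {L₁ L₂ : Lamination}
    (hf : f ∈ HomeoPlus) (h₁ : L₁.IsVeryFull) (hinv₁ : L₁.PreservedBy f) (h₂ : L₂.IsVeryFull)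
    (hinv₂ : L₂.PreservedBy f) (hdisj : Disjoint L₁.endpoints L₂.endpoints) {a r : Circle}
    (har : a ≠ r) (hfix : Fix f = {a, r}) : IsHyperbolic f := by
  obtain ⟨e, he, rfl, c, hc⟩ := exists_coord r
  have hfr : f (e Real.pi) = e Real.pi := by
    have : e Real.pi ∈ Fix f := by rw [hfix]; simp
    exact this
  obtain ⟨F, hF⟩ := exists_isLift hf hc hfr
  obtain ⟨x, hx, rfl⟩ := he.exists_angle har
  have hFx : F x = x := (hF.fixed_iff he hx).1 (by
    have : e x ∈ Fix f := by rw [hfix]; simp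
    exact this)
  have hno : ∀ t ∈ Ioo (-Real.pi) Real.pi, t ≠ x → F t ≠ t := by
    intro t ht htx hFt
    have : e t ∈ Fix f := (hF.fixed_iff he ht).2 hFt
    rw [hfix] at this
    rcases this with h | h
    · exact htx (he.injOn ht hx h)
    · exact he.ne_base ht h
  have hsides : ∃ u ∈ Ioo (-Real.pi) x, ∃ v ∈ Ioo x Real.pi,
      ((u < F u ∧ F v < v) ∨ (F u < u ∧ v < F v)) := by
    have key : ∀ L : Lamination, L.IsVeryFull → L.PreservedBy f → e x ∉ L.endpoints →
        ∃ u ∈ Ioo (-Real.pi) x, ∃ v ∈ Ioo x Real.pi,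
          ((u < F u ∧ F v < v) ∨ (F u < u ∧ v < F v)) := by
      intro L hL hinv hxL
      obtain ⟨u, hu, v, hv, -, h⟩ := exists_leaf_around he hF hL hinv hx.1 hx.2 le_rfl le_rfl
        hF.map_neg_pi hFx hF.map_pi (fun t ht => hno t ⟨ht.1, ht.2.trans hx.2⟩ ht.2.ne)
        (fun t ht => hno t ⟨hx.1.trans ht.1, ht.2⟩ ht.1.ne') hxL
      exact ⟨u, hu, v, hv, h⟩
    by_cases hE : e x ∈ L₁.endpoints
    · exact key L₂ h₂ hinv₂ (disjoint_left.1 hdisj hE)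
    · exact key L₁ h₁ hinv₁ hE
  obtain ⟨u, hu, v, hv, ⟨h1, h2⟩ | ⟨h1, h2⟩⟩ := hsides
  · obtain ⟨ha, hr⟩ := isAttracting_and_isRepelling_of_lift hc hF hx hfix hu hv h1 h2
    exact ⟨_, _, har, hfix, ha, hr⟩
  · obtain ⟨ha, hr⟩ := isAttracting_and_isRepelling_of_lift hc hF.symm hx (by rw [Fix_inv, hfix])
      hu hv ((OrderIso.lt_symm_apply F).2 h1) ((OrderIso.symm_apply_lt F).2 h2)
    have h3 := ha.inv
    have h4 := hr.inv
    rw [inv_inv] at h3 h4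
    exact ⟨_, _, har.symm, by rw [hfix, pair_comm], h4, h3⟩

/-! ### Centralizers of hyperbolic elements -/

theorem infinite_univ_circle : (univ : Set Circle).Infinite := by
  obtain ⟨e, he, -⟩ := exists_coord 1
  exact infinite_of_injOn_mapsTo he.injOn (mapsTo_univ _ _)
    (Ioo_infinite (by linarith [Real.pi_pos]))

theorem Fix_one : Fix 1 = univ := eq_univ_of_forall fun _ => rfl

theorem not_isHyperbolic_one : ¬ IsHyperbolic 1 := by
  rintro ⟨a, r, -, hfix, -⟩
  rw [Fix_one] at hfix
  exact infinite_univ_circle (hfix ▸ toFinite _)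

/-- If `f` has a fixed point, then its periodic points are fixed. -/
theorem mem_Fix_of_mem_Fix_pow {f : Circle ≃ₜ Circle} (hf : f ∈ HomeoPlus) {p x : Circle}
    (hp : p ∈ Fix f) {n : ℕ} (hn : 0 < n) (hx : x ∈ Fix (f ^ n)) : x ∈ Fix f := by
  obtain ⟨e, he, rfl, c, hc⟩ := exists_coord p
  obtain ⟨F, hF⟩ := exists_isLift hf hc hp
  by_cases hxp : x = e Real.pi
  · rw [hxp]; exact hp
  obtain ⟨t, ht, rfl⟩ := he.exists_angle hxp
  have hiter : ∀ n : ℕ, F^[n] t ∈ Ioo (-Real.pi) Real.pi ∧ (f ^ n) (e t) = e (F^[n] t) := by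
    intro n
    induction n with
    | zero => exact ⟨ht, rfl⟩
    | succ n ih =>
      rw [Function.iterate_succ_apply', pow_succ']
      refine ⟨hF.mem_Ioo ih.1, ?_⟩
      change f ((f ^ n) (e t)) = _
      rw [ih.2, hF.apply_eq _ (Ioo_subset_Icc_self ih.1)]
  have hFn : F^[n] t = t := he.injOn (hiter n).1 ht ((hiter n).2.symm.trans hx)
  refine (hF.fixed_iff he ht).2 ?_
  rcases lt_trichotomy t (F t) with h | h | h
  · have := F.strictMono.strictMono_iterate_of_lt_map h hn
    exact (this.ne' hFn).elim
  · exact h.symm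
  · have := F.strictMono.strictAnti_iterate_of_map_lt h hn
    exact (this.ne hFn).elim

/-- A map that commutes with a hyperbolic one fixes its attracting and its repelling point, and
does not swap them. -/
theorem apply_eq_of_commute {f g : Circle ≃ₜ Circle} (hf : f ∈ HomeoPlus) (hg : g ∈ HomeoPlus)
    {a r : Circle} (har : a ≠ r) (hfix : Fix f = {a, r}) (ha : IsAttracting f a)
    (hr : IsRepelling f r) (hgf : g * f = f * g) : g a = a ∧ g r = r := by
  have hconj : g * f * g⁻¹ = f := by rw [hgf, mul_inv_cancel_right]
  have ha' := ha.conj hg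
  rw [hconj] at ha'
  have h1 : g a ∈ Fix f := ha'.1
  have h2 : g r ∈ Fix f := by
    rw [← hconj, Fix_conj]
    exact mem_image_of_mem g (by rw [hfix]; simp)
  rw [hfix] at h1 h2
  have h3 : g a = a := by
    rcases h1 with h | h
    · exact h
    · rw [h] at ha'
      exact (ha'.not_isRepelling hf har.symm (by rw [hfix, pair_comm]) hr).elim
  refine ⟨h3, h2.resolve_left fun h => har ?_⟩
  exact g.injective (h3.trans h.symm)

variable {G : Subgroup (Circle ≃ₜ Circle)}

/-- In a pseudo-fibered group the centralizer of a hyperbolic element contains, besides the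
identity, only hyperbolic elements: the finite set of fixed points of such an element is invariant
under the hyperbolic one, hence consists of the two fixed points of the latter. -/
theorem IsPseudoFibered.isHyperbolic_of_commute (hG : IsPseudoFibered G) {f g : Circle ≃ₜ Circle}
    (hf : f ∈ G) (hg : g ∈ G) (hhyp : IsHyperbolic f) (hgf : g * f = f * g) :
    g = 1 ∨ IsHyperbolic g := by
  obtain ⟨-, ⟨hplus, -, -⟩, ⟨L₁, L₂, h₁, h₁', hinv₁, h₂, h₂', hinv₂, hdisj⟩, hcount⟩ := hG
  by_cases hg1 : g = 1
  · exact Or.inl hg1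
  right
  obtain ⟨a, r, har, hfix, ha, hr⟩ := hhyp
  obtain ⟨hga, hgr⟩ := apply_eq_of_commute (hplus hf) (hplus hg) har hfix ha hr hgf
  have hfin := finite_Fix (hplus hg) h₁ h₁' (hinv₁ g hg) h₂ h₂' (hinv₂ g hg) hdisj
    (hcount g hg hg1)
  have hsub : Fix g ⊆ Fix f := by
    intro x hx
    have hmem : ∀ n : ℕ, (f ^ n) x ∈ Fix g := by
      intro n
      have hcomm : g * f ^ n = f ^ n * g := (Commute.pow_right (a := g) (b := f) hgf n).eq
      have h := congrArg (fun k : Circle ≃ₜ Circle => k x) hcomm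
      change g ((f ^ n) x) = (f ^ n) (g x) at h
      rw [show g x = x from hx] at h
      exact h
    obtain ⟨i, j, hij, h⟩ := hfin.exists_lt_map_eq_of_forall_mem hmem
    refine mem_Fix_of_mem_Fix_pow (hplus hf) (p := a) (by rw [hfix]; simp) (n := j - i)
      (by omega) ?_
    refine (f ^ i).injective ?_
    change (f ^ i * f ^ (j - i)) x = (f ^ i) x
    rw [← pow_add, Nat.add_sub_cancel' hij.le, h]
  have hfixg : Fix g = {a, r} := by
    refine (hsub.trans hfix.subset).antisymm ?_
    rintro y (rfl | rfl)
    · exact hga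
    · exact hgr
  exact isHyperbolic_of_Fix_eq_pair (hplus hg) h₁ (hinv₁ g hg) h₂ (hinv₂ g hg) hdisj har hfixg

/-- No power of a pseudo-Anosov-like element is hyperbolic, since the element would commute with
it, and none is the identity, since some power has fixed points but only finitely many. -/
theorem IsPALike.pow_not_hyperbolic (hG : IsPseudoFibered G) {f : Circle ≃ₜ Circle} (hf : f ∈ G)
    (hPA : IsPALike f) {n : ℕ} (hn : 0 < n) : f ^ n ≠ 1 ∧ ¬ IsHyperbolic (f ^ n) := by
  obtain ⟨hnot, m, hm, hfin, hpos, -, -⟩ := hPA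
  have hplus := hG.2.1.1
  have h1 : f ^ n ≠ 1 := by
    intro h
    obtain ⟨p, hp⟩ := nonempty_of_ncard_ne_zero hpos.ne'
    refine infinite_univ_circle (hfin.subset fun x _ => ?_)
    refine mem_Fix_of_mem_Fix_pow (hplus (G.pow_mem hf m)) hp hn ?_
    rw [← pow_mul, mul_comm, pow_mul, h, one_pow]
    rfl
  refine ⟨h1, fun hhyp => ?_⟩
  rcases hG.isHyperbolic_of_commute (G.pow_mem hf n) hf hhyp (Commute.self_pow f n).eq with h | h
  · exact h1 (by rw [h, one_pow])
  · exact hnot h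

/-! ### The normal subgroup of hyperbolic elements -/

/-- The identity and the hyperbolic elements of a tame group. -/
def hyperbolicSubgroup (G : Subgroup (Circle ≃ₜ Circle)) (htame : IsTame G) : Subgroup G where
  carrier := {g | g = 1 ∨ IsHyperbolic (g : Circle ≃ₜ Circle)}
  one_mem' := Or.inl rfl
  mul_mem' := by
    rintro g h (rfl | hg) (rfl | hh)
    · exact Or.inl (one_mul 1)
    · exact Or.inr (by rwa [one_mul])
    · exact Or.inr (by rwa [mul_one])
    · exact (htame g g.2 h h.2 hg hh).imp (fun h => Subtype.ext h) id
  inv_mem' := by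
    rintro g (rfl | hg)
    · exact Or.inl inv_one
    · exact Or.inr hg.inv

theorem hyperbolicSubgroup_normal (hG : G ≤ HomeoPlus) (htame : IsTame G) :
    (hyperbolicSubgroup G htame).Normal where
  conj_mem := by
    rintro h (rfl | hh) g
    · exact Or.inl (by simp)
    · exact Or.inr (hh.conj (hG g.2))

/-- If `φ ^ n` maps the conjugacy class of `h` in `H` to itself, then some element of the coset
`H φ ^ n` commutes with `h`. -/
theorem exists_mul_pow_commute {G : Type*} [Group G] {H : Subgroup G} [H.Normal] {φ : G} {h : H}
    {n : ℕ} (hfix : (outOnClasses H ((MulAut.conjNormal φ : MulAut H) : Out H) ^ n)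
      (ConjClasses.mk h) = ConjClasses.mk h) : ∃ k : H, (k * φ ^ n) * h = h * (k * φ ^ n) := by
  rw [← map_pow, ← QuotientGroup.mk_pow, ← map_pow] at hfix
  have h1 : ConjClasses.mk ((MulAut.conjNormal (φ ^ n) : MulAut H) h) = ConjClasses.mk h := hfix
  obtain ⟨k, hk⟩ := isConj_iff.1 (ConjClasses.mk_eq_mk_iff_isConj.1 h1)
  refine ⟨k, ?_⟩
  have hk' := congrArg (Subtype.val : H → G) hk
  simp only [Subgroup.coe_mul, Subgroup.coe_inv, MulAut.conjNormal_apply] at hk'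
  conv_rhs => rw [← hk']
  group

end CircleLam

open CircleLam
theorem mainTheorem7 (G : Subgroup (Circle ≃ₜ Circle)) (hmixed : IsMixed G) (htame : IsTame G) :
    ∃ (H : Subgroup G) (_ : H.Normal),
      (∀ g : G, g ∈ H ↔ (g = 1 ∨ IsHyperbolic (g : Circle ≃ₜ Circle))) ∧
      ∀ φ : G, IsPALike (φ : Circle ≃ₜ Circle) →
        (((MulAut.conjNormal φ : MulAut H) : Out H) ≠ 1) ∧
        ∀ C : ConjClasses H, C ≠ 1 → ∀ n : ℕ, 0 < n →
          ((outOnClasses H ((MulAut.conjNormal φ : MulAut H) : Out H)) ^ n) C ≠ C := by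
  obtain ⟨hG, ⟨g₀, hg₀, hyp₀⟩, -⟩ := hmixed
  have hnormal := hyperbolicSubgroup_normal hG.2.1.1 htame
  refine ⟨hyperbolicSubgroup G htame, hnormal, fun g => Iff.rfl, fun φ hφ => ?_⟩
  have key : ∀ C : ConjClasses (hyperbolicSubgroup G htame), C ≠ 1 → ∀ n : ℕ, 0 < n →
      ((outOnClasses _ ((MulAut.conjNormal φ : MulAut (hyperbolicSubgroup G htame)) :
        Out (hyperbolicSubgroup G htame))) ^ n) C ≠ C := by
    rintro ⟨h⟩ hC n hn hfix
    obtain ⟨k, hk⟩ := exists_mul_pow_commute (h := h) hfix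
    have hhyp : IsHyperbolic ((h : G) : Circle ≃ₜ Circle) := by
      refine h.2.resolve_left fun h1 => hC ?_
      have : h = 1 := Subtype.ext h1
      rw [this]
      rfl
    have hmem : (k * φ ^ n : G) ∈ hyperbolicSubgroup G htame := by
      have := hG.isHyperbolic_of_commute (h : G).2 (k * φ ^ n : G).2 hhyp
        (congrArg Subtype.val hk)
      exact this.imp (fun h => Subtype.ext h) id
    have hpow : φ ^ n ∈ hyperbolicSubgroup G htame :=
      ((hyperbolicSubgroup G htame).mul_mem_cancel_left k.2).1 hmem
    obtain ⟨h1, h2⟩ := hφ.pow_not_hyperbolic hG φ.2 hn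
    rcases hpow with h | h
    · exact h1 (congrArg Subtype.val h)
    · exact h2 h
  refine ⟨fun hone => ?_, key⟩
  -- a trivial outer automorphism would fix the class of a hyperbolic element
  set h₀ : hyperbolicSubgroup G htame := ⟨⟨g₀, hg₀⟩, Or.inr hyp₀⟩ with hh₀
  have hne : ConjClasses.mk h₀ ≠ 1 := by
    intro h
    have h1 : IsConj h₀ 1 := ConjClasses.mk_eq_mk_iff_isConj.1 h
    have h2 : h₀ = 1 := isConj_one_left.1 h1
    have h3 : g₀ = 1 :=
      congrArg (fun x : hyperbolicSubgroup G htame => ((x : G) : Circle ≃ₜ Circle)) h2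
    exact not_isHyperbolic_one (h3 ▸ hyp₀)
  refine key _ hne 1 one_pos ?_
  rw [hone, map_one, one_pow]
  rfl
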